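/- **Setting.** Let $\{|0\rangle,|1\rangle\}$ and $\{|0'\rangle,|1'\rangle\}$ be orthonormal bases of a qubit input space and a qubit output space. Let $\mathcal E$ be a quantum symmetric channel (QSC) whose basis transition probability matrix (BTPM) with respect to these bases is $A=(A_{ik})_{i,k\in\{0,1\}}$. That is, $A$ has non-negative entries and row sums $1$, each row is a permutation of the first row, each column is a permutation of the first column, and $\mathcal E(|i\rangle\langle i|)=\sum_k A_{ik}|k'\rangle\langle k'|$; and $\mathcal E(\rho)=E_0\rho E_0^\dagger+E_1\rho E_1^\dagger$ is the trace-preserving map with the operation elements given by $A$, $$E_k|i\rangle=\sqrt{A_{i,\,k\oplus i}}\;|(k\oplus i)'\rangle ,\qquad k,i\in\{0,1\}.$$ Let $W$ be a classical binary symmetric channel whose transition probability matrix is $A$. For $N=2^n$, $n\ge 0$, let $G_N$ be Arıkan's polar transform: $G_1$ is the identity, and $uG_N$ is obtained by adding (mod 2) each even-numbered bit of $u=(u_1,\dots,u_N)$ to the odd-numbered bit just before it (CNOT gates), moving the odd-numbered positions to the first half and the even-numbered ones to the second half (SWAP gates), and applying $G_{N/2}$ to each half. Let $U_N$ be the unitary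 with $U_N|Q_1\cdots Q_N\rangle=|(Q_1\cdots Q_N)G_N\rangle$ in the product basis. The combined channels are $$\mathcal E_N(\rho)=\mathcal E^{\otimes N}(U_N\rho U_N^\dagger),\qquad W_N(y|u)=\prod_{j=1}^N W\big(y_j\,|\,(uG_N)_j\big).$$ For $1\le i\le N$ the classical coordinate channel is $$W_N^{(i)}(y_1^N,u_1^{i-1}|u_i)=\sum_{u_{i+1}^N}2^{-(N-1)}W_N(y_1^N|u_1^N).$$ The quantum coordinate channel $\mathcal E_N^{(i)}$ maps the state $\rho$ of $Q_i$ to the joint state of the outputs $V_1\cdots V_N$ of $\mathcal E_N$ and the references $R_1\cdots R_{i-1}$, where each $Q_j$ with $j\neq i$ is in the maximally entangled state $\tfrac1{\sqrt2}(|00\rangle+|11\rangle)$ with its own reference qubit $R_j$. Entropies are in bits; $S$ is von Neumann entropy and $H$ is Shannon entropy. For a channel $\Phi$ and a density operator $\rho$ on its input $Q$, purified by a reference $R$, the coherent information is $I(\rho,\Phi)=S(\Phi(\rho))-S\big((\Phi\otimes\mathrm{id}_R)(|\psi_{QR}\rangle\langle\psi_{QR}|)\big)$. The maximum single-letter coherent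 information (MSLCI) of $\Phi$ is the maximum of $I(\rho,\Phi)$ over all density operators $\rho$. **Theorem 7.** (a) For all $n\ge0$, $N=2^n$ and $1\le i\le N$, the MSLCI of $\mathcal E_N^{(i)}$ is attained at the completely mixed input $\rho^{Q_i}=\frac12|0\rangle\langle0|+\frac12|1\rangle\langle1|$, and $$I(\rho^{Q_i},\mathcal E_N^{(i)})=S(\rho^{V_1^N,R_1^{i-1}})-S(\rho^{V_1^N,R_1^{i}})=I(W_N^{(i)})=H(y_1^N u_1^{i-1})-H(y_1^N u_1^i)+H(u_i).$$ Here $\rho^{V_1^N,R_1^m}$ is the state of the outputs and the first $m$ references when every $Q_j$ is maximally entangled with $R_j$; $u_i$ is uniform on $\{0,1\}$ and $(y_1^N,u_1^{i-1})$ is the corresponding output of $W_N^{(i)}$. The number $I(W_N^{(i)})$ is the symmetric capacity of $W_N^{(i)}$, and it is equal to the Shannon capacity of $W_N^{(i)}$. (b) Consequently the quantum coordinate channels polarize: for every $\delta\in(0,1)$, as $N=2^n\to\infty$, the fraction of indices $i\in\{1,\dots,N\}$ for which the MSLCI of $\mathcal E_N^{(i)}$ lies in $(1-\delta,1]$ tends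 to the MSLCI of $\mathcal E$, and the fraction for which it lies in $[0,\delta)$ tends to $1$ minus the MSLCI of $\mathcal E$. -/

import Mathlib

open Filter Topology
open scoped Matrix ComplexOrder

noncomputable section

namespace QuantumPolar

/-! ### States, channels, entropy, coherent information -/

section General

variable {a b r t κ : Type*} [Fintype a] [DecidableEq a] [Fintype b] [DecidableEq b]
  [Fintype r] [DecidableEq r] [Fintype t] [DecidableEq t] [Fintype κ]

/-- Density operators: positive semidefinite matrices of trace one. -/
def IsDensity (ρ : Matrix a a ℂ) : Prop := ρ.PosSemidef ∧ ρ.trace = 1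

/-- The projector `|ψ⟩⟨ψ|`. -/
def proj (ψ : a → ℂ) : Matrix a a ℂ := Matrix.vecMulVec ψ (star ψ)

/-- The map `ρ ↦ ∑ₖ Kₖ ρ Kₖ†` with operation elements `Kₖ`. -/
def krausMap (K : κ → Matrix b a ℂ) : Matrix a a ℂ →ₗ[ℂ] Matrix b b ℂ where
  toFun ρ := ∑ k, K k * ρ * (K k)ᴴ
  map_add' ρ σ := by simp [Matrix.mul_add, Matrix.add_mul, Finset.sum_add_distrib]
  map_smul' c ρ := by simp [Finset.smul_sum]

/-- `Φ ⊗ id` on a bipartite system: `Φ` acts on the first factor. -/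
def applyLeft (Φ : Matrix a a ℂ →ₗ[ℂ] Matrix b b ℂ) :
    Matrix (a × r) (a × r) ℂ →ₗ[ℂ] Matrix (b × r) (b × r) ℂ where
  toFun M := Matrix.of fun v w =>
    Φ (Matrix.of fun q q' => M (q, v.2) (q', w.2)) v.1 w.1
  map_add' M M' := by
    ext v w
    have h : (Matrix.of fun q q' => (M + M') (q, v.2) (q', w.2)) =
        (Matrix.of fun q q' => M (q, v.2) (q', w.2)) +
          (Matrix.of fun q q' => M' (q, v.2) (q', w.2)) := rfl
    simp only [Matrix.of_apply, Matrix.add_apply]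
    rw [← Matrix.add_apply, ← map_add, ← h]
    rfl
  map_smul' c M := by
    ext v w
    have h : (Matrix.of fun q q' => (c • M) (q, v.2) (q', w.2)) =
        c • (Matrix.of fun q q' => M (q, v.2) (q', w.2)) := rfl
    simp only [Matrix.of_apply, Matrix.smul_apply, RingHom.id_apply]
    rw [← Matrix.smul_apply, ← map_smul, ← h]
    rfl

/-- Partial trace over the last system of a tripartite system. -/
def traceLast : Matrix (b × r × t) (b × r × t) ℂ →ₗ[ℂ] Matrix (b × r) (b × r) ℂ where
  toFun M := Matrix.of fun v w => ∑ s, M (v.1, v.2, s) (w.1, w.2, s)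
  map_add' M M' := by ext v w; simp [Finset.sum_add_distrib]
  map_smul' c M := by ext v w; simp [Finset.mul_sum]

/-- Shannon entropy in bits. -/
def shannonEntropy (p : a → ℝ) : ℝ := ∑ x, Real.negMulLog (p x) / Real.log 2

open Classical in
/-- Von Neumann entropy in bits: the Shannon entropy of the eigenvalues
(with the value `0` on matrices that are not Hermitian). -/
def vonNeumannEntropy (ρ : Matrix a a ℂ) : ℝ :=
  if h : ρ.IsHermitian then shannonEntropy h.eigenvalues else 0

/-- The purification `∑ᵢ √pᵢ |i⟩|i⟩` of `ρ = ∑ᵢ pᵢ |i⟩⟨i|` (spectral decomposition), the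
reference system having the same state space. -/
def purification {ρ : Matrix a a ℂ} (h : ρ.IsHermitian) : a × a → ℂ := fun x =>
  ∑ i, (Real.sqrt (h.eigenvalues i) : ℂ) * h.eigenvectorBasis i x.1 * h.eigenvectorBasis i x.2

open Classical in
/-- Coherent information `I(ρ, Φ) = S(Q') - S(RQ')`
(with the value `0` if `ρ` is not Hermitian). -/
def coherentInfo (ρ : Matrix a a ℂ) (Φ : Matrix a a ℂ →ₗ[ℂ] Matrix b b ℂ) : ℝ :=
  if h : ρ.IsHermitian then
    vonNeumannEntropy (Φ ρ) - vonNeumannEntropy (applyLeft Φ (proj (purification h)))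
  else 0

/-- Maximum single-letter coherent information: the supremum of the coherent information
over all input density operators. -/
def mslci (Φ : Matrix a a ℂ →ₗ[ℂ] Matrix b b ℂ) : ℝ :=
  sSup ((fun ρ => coherentInfo ρ Φ) '' {ρ | IsDensity ρ})

/-! ### Classical channels; `P x y` is the probability of output `y` given input `x` -/

/-- Mutual information of input and output, `H(Y) - H(X,Y) + H(X)`, for input distribution `q`. -/
def mutualInfo (q : a → ℝ) (P : a → b → ℝ) : ℝ :=
  shannonEntropy (fun y => ∑ x, q x * P x y) -
    shannonEntropy (fun z : a × b => q z.1 * P z.1 z.2) + shannonEntropy q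

/-- Shannon capacity. -/
def shannonCapacity (P : a → b → ℝ) : ℝ :=
  sSup ((fun q => mutualInfo q P) '' stdSimplex ℝ a)

end General

/-- Symmetric capacity of a binary-input channel: mutual information at the uniform input. -/
def symmetricCapacity {b : Type*} [Fintype b] (P : Fin 2 → b → ℝ) : ℝ :=
  mutualInfo (fun _ => 1 / 2) P

/-! ### Bit strings and the recursive encoding circuit -/

/-- Bit strings of length `N`; addition in `Fin 2` is XOR. They index the computational basis of
`N` qubits. -/
abbrev Bits (N : ℕ) := Fin N → Fin 2

/-- Values on the first `m` coordinates out of `N`. -/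
abbrev Before (N m : ℕ) := {j : Fin N // (j : ℕ) < m} → Fin 2

/-- Values on the coordinates from position `m` on (counted from `0`) out of `N`. -/
abbrev After (N m : ℕ) := {j : Fin N // m ≤ (j : ℕ)} → Fin 2

/-- The string consisting of the first `m` coordinates `r` and the remaining ones `t`. -/
def join {N m : ℕ} (r : Before N m) (t : After N m) : Bits N := fun j =>
  if h : (j : ℕ) < m then r ⟨j, h⟩ else t ⟨j, not_lt.mp h⟩

/-- The string with `r` before position `i`, `x` at position `i`, and `t` after it. -/
def join₃ {N : ℕ} (i : Fin N) (r : Before N i) (x : Fin 2) (t : After N (i + 1)) : Bits N :=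
  fun j =>
    if h : (j : ℕ) < i then r ⟨j, h⟩
    else if h' : (i : ℕ) + 1 ≤ j then t ⟨j, h'⟩
    else x

theorem double_lt {n k : ℕ} (h : k < 2 ^ n) : 2 * k < 2 ^ (n + 1) := by
  rw [pow_succ]; omega

theorem double_succ_lt {n k : ℕ} (h : k < 2 ^ n) : 2 * k + 1 < 2 ^ (n + 1) := by
  rw [pow_succ]; omega

theorem add_half_lt {n k : ℕ} (h : k < 2 ^ n) : 2 ^ n + k < 2 ^ (n + 1) := by
  rw [pow_succ]; omega

theorem lt_of_lt_half {n k : ℕ} (h : k < 2 ^ n) : k < 2 ^ (n + 1) := by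
  rw [pow_succ]; omega

theorem sub_half_lt {n k : ℕ} (hk : k < 2 ^ (n + 1)) (h : ¬ k < 2 ^ n) : k - 2 ^ n < 2 ^ n := by
  rw [pow_succ] at hk; omega

theorem succ_lt_of_even {n k : ℕ} (hk : k < 2 ^ (n + 1)) (h : k % 2 = 0) :
    k + 1 < 2 ^ (n + 1) := by
  rw [pow_succ] at *; omega

/-- One layer of CNOT gates: in each pair of neighbouring positions `(2k, 2k+1)` (counted from
`0`), the second is the control and the first is the target. -/
def cnotLayer {n : ℕ} (u : Bits (2 ^ (n + 1))) : Bits (2 ^ (n + 1)) := fun k =>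
  if h : (k : ℕ) % 2 = 0 then u k + u ⟨k + 1, succ_lt_of_even k.2 h⟩ else u k

/-- The reverse shuffle, a permutation of the positions (a sequence of SWAP gates):
`(s₁, s₂, …, s_N) ↦ (s₁, s₃, …, s_{N-1}, s₂, s₄, …, s_N)`. -/
def reverseShuffle {n : ℕ} (s : Bits (2 ^ (n + 1))) : Bits (2 ^ (n + 1)) := fun k =>
  if h : (k : ℕ) < 2 ^ n then s ⟨2 * k, double_lt h⟩
  else s ⟨2 * (k - 2 ^ n) + 1, double_succ_lt (sub_half_lt k.2 h)⟩

/-- The encoding map `u ↦ u G_N`, `N = 2 ^ n`: a CNOT layer, the reverse shuffle, and then the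
encoding of half the length on each of the two halves. -/
def encode : (n : ℕ) → Bits (2 ^ n) → Bits (2 ^ n)
  | 0, u => u
  | n + 1, u => fun k =>
      if h : (k : ℕ) < 2 ^ n then
        encode n (fun j => reverseShuffle (cnotLayer u) ⟨j, lt_of_lt_half j.2⟩) ⟨k, h⟩
      else
        encode n (fun j => reverseShuffle (cnotLayer u) ⟨2 ^ n + j, add_half_lt j.2⟩)
          ⟨k - 2 ^ n, sub_half_lt k.2 h⟩

/-! ### Classical combined and coordinate channels -/

/-- `W` is the transition probability matrix of a binary symmetric channel. -/
def IsBSC (W : Matrix (Fin 2) (Fin 2) ℝ) : Prop :=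
  ∃ p : ℝ, 0 ≤ p ∧ p ≤ 1 ∧ W = !![1 - p, p; p, 1 - p]

/-- The combined channel `W_N(y | u) = ∏ⱼ W(yⱼ | (u G_N)ⱼ)`, `N = 2 ^ n`. -/
def combinedClassical (W : Matrix (Fin 2) (Fin 2) ℝ) (n : ℕ) (u y : Bits (2 ^ n)) : ℝ :=
  ∏ j, W (encode n u j) (y j)

/-- The coordinate channel `W_N^{(i)}`, with input `uᵢ` and output the pair of `y` and the bits
before position `i`:  `∑_t 2^{-(N-1)} W_N(y | r, uᵢ, t)`. -/
def coordinateClassical (W : Matrix (Fin 2) (Fin 2) ℝ) (n : ℕ) (i : Fin (2 ^ n))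
    (x : Fin 2) (z : Bits (2 ^ n) × Before (2 ^ n) i) : ℝ :=
  ∑ t : After (2 ^ n) (i + 1),
    1 / 2 ^ (2 ^ n - 1) * combinedClassical W n (join₃ i z.2 x t) z.1

/-! ### Quantum symmetric channels with qubit input and qubit output -/

/-- Orthonormal bases of a qubit. -/
abbrev QubitBasis := OrthonormalBasis (Fin 2) ℂ (EuclideanSpace ℂ (Fin 2))

/-- The coordinate vector of the `i`-th basis vector. -/
def ket (e : QubitBasis) (i : Fin 2) : Fin 2 → ℂ := fun x => e i x

/-- `A` is the basis transition probability matrix of `Φ` for the input basis `e` and the output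
basis `f`: its rows are probability vectors and `Φ(|i⟩⟨i|) = ∑ₖ A i k |k'⟩⟨k'|`. -/
def HasBTPM (Φ : Matrix (Fin 2) (Fin 2) ℂ →ₗ[ℂ] Matrix (Fin 2) (Fin 2) ℂ) (e f : QubitBasis)
    (A : Matrix (Fin 2) (Fin 2) ℝ) : Prop :=
  (∀ i k, 0 ≤ A i k) ∧ (∀ i, ∑ k, A i k = 1) ∧
    ∀ i, Φ (proj (ket e i)) = ∑ k, (A i k : ℂ) • proj (ket f k)

/-- The operation elements `E₀, E₁` form a quantum symmetric channel with basis transition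
probability matrix `A` for the input basis `e` and the output basis `f`. The last clause says that
the operation elements are the ones read off from the matrix `A`:
`E₀|0⟩ = √A₀₀ |0'⟩`, `E₁|0⟩ = √A₀₁ |1'⟩`, `E₀|1⟩ = √A₁₁ |1'⟩`, `E₁|1⟩ = √A₁₀ |0'⟩`. -/
structure IsQSC (e f : QubitBasis) (A : Matrix (Fin 2) (Fin 2) ℝ)
    (E : Fin 2 → Matrix (Fin 2) (Fin 2) ℂ) : Prop where
  tracePreserving : ∑ k, (E k)ᴴ * E k = 1
  btpm : HasBTPM (krausMap E) e f A
  rows_perm : ∀ i, ∃ σ : Equiv.Perm (Fin 2), ∀ k, A i k = A 0 (σ k)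
  cols_perm : ∀ k, ∃ σ : Equiv.Perm (Fin 2), ∀ i, A i k = A (σ i) 0
  elements : ∀ k i, E k *ᵥ ket e i = (Real.sqrt (A i (k + i)) : ℂ) • ket f (k + i)

/-! ### Quantum combined and coordinate channels -/

/-- The product vector `|Q₁⟩ ⊗ ⋯ ⊗ |Q_N⟩`. -/
def ketN (e : QubitBasis) {N : ℕ} (Q : Bits N) : Bits N → ℂ := fun x => ∏ j, ket e (Q j) (x j)

/-- The encoding unitary `U_N = ∑_Q |Q G_N⟩⟨Q|`: the circuit of CNOT and SWAP gates (with respect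
to the basis `e`). -/
def encodingUnitary (e : QubitBasis) (n : ℕ) : Matrix (Bits (2 ^ n)) (Bits (2 ^ n)) ℂ :=
  ∑ Q : Bits (2 ^ n), Matrix.vecMulVec (ketN e (encode n Q)) (star (ketN e Q))

/-- The operation elements `E_{k₁} ⊗ ⋯ ⊗ E_{k_N}` of the `N`-copy channel. -/
def nCopyElement (E : Fin 2 → Matrix (Fin 2) (Fin 2) ℂ) {N : ℕ} (k : Bits N) :
    Matrix (Bits N) (Bits N) ℂ :=
  Matrix.of fun x y => ∏ j, E (k j) (x j) (y j)

/-- The combined channel: the encoding unitary followed by the `N`-copy channel, `N = 2 ^ n`. -/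
def combinedChannel (e : QubitBasis) (E : Fin 2 → Matrix (Fin 2) (Fin 2) ℂ) (n : ℕ) :
    Matrix (Bits (2 ^ n)) (Bits (2 ^ n)) ℂ →ₗ[ℂ] Matrix (Bits (2 ^ n)) (Bits (2 ^ n)) ℂ :=
  krausMap (nCopyElement E) ∘ₗ krausMap (fun _ : Unit => encodingUnitary e n)

/-- The maximally entangled state `(|0⟩|0⟩ + |1⟩|1⟩) / √2` of a qubit and its reference. -/
def bell (e : QubitBasis) (q r : Fin 2) : ℂ :=
  ∑ i, (Real.sqrt (1 / 2) : ℂ) * ket e i q * ket e i r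

/-- The state of `Q₁ ⋯ Q_N` and the references of all `Qⱼ`, `j ≠ i`, when `Qᵢ` is in state `ρ` and
every other `Qⱼ` is maximally entangled with its reference. The references before and after
position `i` are listed separately. -/
def coordinateInput (e : QubitBasis) {N : ℕ} (i : Fin N) :
    Matrix (Fin 2) (Fin 2) ℂ →ₗ[ℂ]
      Matrix (Bits N × Before N i × After N (i + 1)) (Bits N × Before N i × After N (i + 1)) ℂ where
  toFun ρ := Matrix.of fun z w =>
    ρ (z.1 i) (w.1 i) *
      ((∏ j, bell e (z.1 j.1) (z.2.1 j)) * ∏ j, bell e (z.1 j.1) (z.2.2 j)) *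
      star ((∏ j, bell e (w.1 j.1) (w.2.1 j)) * ∏ j, bell e (w.1 j.1) (w.2.2 j))
  map_add' ρ σ := by ext z w; simp [add_mul]
  map_smul' c ρ := by ext z w; simp [mul_assoc]

/-- The coordinate channel from `Qᵢ` to `V₁ ⋯ V_N` and the references before position `i`. -/
def coordinateChannel (e : QubitBasis) (E : Fin 2 → Matrix (Fin 2) (Fin 2) ℂ) (n : ℕ)
    (i : Fin (2 ^ n)) :
    Matrix (Fin 2) (Fin 2) ℂ →ₗ[ℂ]
      Matrix (Bits (2 ^ n) × Before (2 ^ n) i) (Bits (2 ^ n) × Before (2 ^ n) i) ℂ :=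
  traceLast ∘ₗ applyLeft (combinedChannel e E n) ∘ₗ coordinateInput e i

/-- The joint state of `V₁ ⋯ V_N` and the first `m` references, when every `Qⱼ` is maximally
entangled with its reference. -/
def outputState (e : QubitBasis) (E : Fin 2 → Matrix (Fin 2) (Fin 2) ℂ) (n m : ℕ) :
    Matrix (Bits (2 ^ n) × Before (2 ^ n) m) (Bits (2 ^ n) × Before (2 ^ n) m) ℂ :=
  traceLast (applyLeft (combinedChannel e E n)
    (proj fun z : Bits (2 ^ n) × Before (2 ^ n) m × After (2 ^ n) m =>
      ∏ j, bell e (z.1 j) (join z.2.1 z.2.2 j)))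

/-- The completely mixed state of a qubit. -/
def completelyMixed : Matrix (Fin 2) (Fin 2) ℂ := (1 / 2 : ℂ) • 1

end QuantumPolar

end

open QuantumPolar

/-! Let w be the first row of A. The operation element `E k` sends |i⟩ to √(w k)|(k+i)'⟩, so the
channel is a random bit flip between the two bases. As G_N is linear over F₂, all quantities are
entropies of one family of classical distributions: `tailDist w n m`, the law of k +
(0,…,0,u_{m+1},…,u_N)G_N with random flips k and uniform u_j. The number attached to position i is
`coordinateInfo w n i`, the entropy of `tailDist w n i` minus that of `tailDist w n (i + 1)`.

Entropies. Tracing out the references of the later qubits turns those qubits into uniform noise,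
while the earlier references only select orthonormal superpositions. So the state of the outputs and
the first m references is isometric to the diagonal matrix of `tailDist w n m` (`outputState_eq`).
The classical coordinate channel has the same noise distribution (`coordinateClassical_eq`), and its
symmetry under translation by a row of G_N makes the uniform input optimal.

Optimality of the mixed input. With g the row of G_N at position i, the coordinate channel maps
|x⟩⟨x'| to a mixture of |φ_{c+xg}⟩⟨φ_{c+x'g}| with orthonormal φ_c and weights `tailDist w n (i + 1)
c` (`coordinateChannel_ket`). Grouped by cosets of {0, g}, this is a bit flip whose two weights
depend on a classical label, the coset. The output and the environment are then block diagonal with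
2×2 blocks, and the coherent information is a sum over cosets of differences of two-eigenvalue
entropies. The scalar inequality `biasEntropy_sub_le` bounds each difference by its value at the
completely mixed input.

Polarization. One step of the recursion makes `tailDist` at an even position a product of two copies
(`tailDist_double`), so the information at i splits into two numbers with the same mean. By
`entropyGain_gap` they separate by at least a constant times I(1 - I)². The average of I² is
monotone and bounded, hence the squared separations average to zero, nearly all the numbers lie near
0 or 1, and the preserved mean fixes the limiting fractions (`tendsto_average_of_split`). -/

noncomputable section

set_option linter.unusedSectionVars false

namespace QuantumPolar

open Real

/-! ### Scalar inequalities for the binary entropy function -/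

/-- The binary entropy (in nats) of a binary random variable with bias `x`. -/
def biasEntropy (x : ℝ) : ℝ := binEntropy ((1 + x) / 2)

theorem biasEntropy_neg (x : ℝ) : biasEntropy (-x) = biasEntropy x := by
  rw [biasEntropy, ← binEntropy_one_sub, biasEntropy]; congr 1; ring

theorem biasEntropy_zero : biasEntropy 0 = log 2 := by
  rw [biasEntropy, ← binEntropy_two_inv]; norm_num

theorem biasEntropy_le_log_two (x : ℝ) : biasEntropy x ≤ log 2 := binEntropy_le_log_two

theorem continuous_biasEntropy : Continuous biasEntropy := by
  unfold biasEntropy; fun_prop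

theorem biasEntropy_antitoneOn : AntitoneOn biasEntropy (Set.Icc 0 1) := by
  intro x hx y hy hxy
  apply binEntropy_strictAntiOn.antitoneOn
  · constructor <;> linarith [hx.1, hx.2]
  · constructor <;> linarith [hy.1, hy.2]
  · linarith

/-- The inverse hyperbolic tangent, minus the derivative of `biasEntropy`. -/
def halfLogRatio (x : ℝ) : ℝ := (log (1 + x) - log (1 - x)) / 2

/-- The series artanh x = ∑ x^(2k+1)/(2k+1) has non-negative terms, and x is its first one. -/
theorem le_halfLogRatio {x : ℝ} (h0 : 0 ≤ x) (h1 : x < 1) : x ≤ halfLogRatio x := by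
  have h := hasSum_log_sub_log_of_abs_lt_one (x := x) (by rw [abs_of_nonneg h0]; exact h1)
  have := h.summable.sum_le_tsum {0} (fun k _ => by positivity)
  rw [h.tsum_eq] at this
  simp at this
  unfold halfLogRatio
  linarith

theorem hasDerivAt_halfLogRatio {x : ℝ} (h0 : -1 < x) (h1 : x < 1) :
    HasDerivAt halfLogRatio (1 / (1 - x ^ 2)) x := by
  have h2 : (1 : ℝ) + x ≠ 0 := by linarith
  have h3 : (1 : ℝ) - x ≠ 0 := by linarith
  have h4 : (1 : ℝ) - x ^ 2 ≠ 0 := by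
    rw [show (1 : ℝ) - x ^ 2 = (1 + x) * (1 - x) by ring]; exact mul_ne_zero h2 h3
  have := ((((hasDerivAt_id x).const_add 1).log h2).sub
    (((hasDerivAt_id x).const_sub 1).log h3)).div_const 2
  refine this.congr_deriv ?_
  simp only [id]
  field_simp
  ring

theorem hasDerivAt_biasEntropy {x : ℝ} (h0 : -1 < x) (h1 : x < 1) :
    HasDerivAt biasEntropy (-halfLogRatio x) x := by
  have h := hasDerivAt_binEntropy (p := (1 + x) / 2) (by linarith) (by linarith)
  have := h.comp x (((hasDerivAt_id x).const_add 1).div_const 2)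
  refine this.congr_deriv ?_
  rw [show (1 : ℝ) - (1 + x) / 2 = (1 - x) / 2 by ring, log_div (by linarith) (by norm_num),
    log_div (by linarith) (by norm_num), halfLogRatio]
  ring

/-- The numerator of the derivative is x - (1 + x²) artanh x, which is non-positive because artanh x
≥ x. This monotonicity is what decides the sign of the derivative in `biasEntropy_sub_le`. -/
theorem antitoneOn_halfLogRatio_mul :
    AntitoneOn (fun x => (1 - x ^ 2) * halfLogRatio x / x) (Set.Ioo 0 1) := by
  have key : ∀ x ∈ Set.Ioo (0 : ℝ) 1, HasDerivAt (fun x => (1 - x ^ 2) * halfLogRatio x / x)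
      ((x - (1 + x ^ 2) * halfLogRatio x) / x ^ 2) x := by
    intro x hx
    have h4 : (1 : ℝ) - x ^ 2 ≠ 0 := by nlinarith [hx.1, hx.2]
    have hx0 : x ≠ 0 := hx.1.ne'
    have := ((((hasDerivAt_id x).pow 2).const_sub 1).mul
      (hasDerivAt_halfLogRatio (by linarith [hx.1]) hx.2)).div (hasDerivAt_id x) hx0
    refine this.congr_deriv ?_
    simp only [id, Pi.mul_apply, Pi.pow_apply]
    field_simp
    ring
  refine antitoneOn_of_deriv_nonpos (convex_Ioo 0 1)
    (fun x hx => (key x hx).continuousAt.continuousWithinAt) ?_ ?_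
  · rw [interior_Ioo]
    exact fun x hx => (key x hx).differentiableAt.differentiableWithinAt
  · rw [interior_Ioo]
    intro x hx
    rw [(key x hx).deriv]
    have := le_halfLogRatio hx.1.le hx.2
    refine div_nonpos_of_nonpos_of_nonneg ?_ (by positivity)
    nlinarith [sq_nonneg x, hx.1]

/-- The bias of the environment of a bit-flip channel is governed by `α² + (1 - α²) x²`; the
difference of the two entropies is largest at `x = 0`. -/
theorem biasEntropy_sub_le {α x : ℝ} (hα0 : 0 ≤ α) (hα1 : α ≤ 1) (hx0 : 0 ≤ x) (hx1 : x ≤ 1) :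
    biasEntropy x - biasEntropy (√(α ^ 2 + (1 - α ^ 2) * x ^ 2)) ≤ log 2 - biasEntropy α := by
  -- For α = 1 the square root is constantly 1, where `biasEntropy` is not differentiable; for α < 1
  -- it stays below 1 when x < 1.
  rcases hα1.eq_or_lt with rfl | hα
  · simpa using biasEntropy_le_log_two x
  have hα2 : 0 < 1 - α ^ 2 := by nlinarith
  have hanti : AntitoneOn (fun x => biasEntropy x - biasEntropy (√(α ^ 2 + (1 - α ^ 2) * x ^ 2)))
      (Set.Icc 0 1) := by
    have key : ∀ x ∈ Set.Ioo (0 : ℝ) 1, HasDerivAt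
        (fun x => biasEntropy x - biasEntropy (√(α ^ 2 + (1 - α ^ 2) * x ^ 2)))
        (-halfLogRatio x - -halfLogRatio (√(α ^ 2 + (1 - α ^ 2) * x ^ 2)) *
          ((1 - α ^ 2) * (2 * x) / (2 * √(α ^ 2 + (1 - α ^ 2) * x ^ 2)))) x ∧
        x ≤ √(α ^ 2 + (1 - α ^ 2) * x ^ 2) ∧ √(α ^ 2 + (1 - α ^ 2) * x ^ 2) < 1 := by
      intro x hx
      have hx2 : x ^ 2 < 1 := by nlinarith [hx.1, hx.2]
      have hpos : 0 < α ^ 2 + (1 - α ^ 2) * x ^ 2 := by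
        have := pow_pos hx.1 2
        positivity
      have hT1 : √(α ^ 2 + (1 - α ^ 2) * x ^ 2) < 1 := by
        rw [sqrt_lt' one_pos]; nlinarith
      have hTx : x ≤ √(α ^ 2 + (1 - α ^ 2) * x ^ 2) := by
        apply le_sqrt_of_sq_le; nlinarith [sq_nonneg α]
      refine ⟨?_, hTx, hT1⟩
      have hin : HasDerivAt (fun x => α ^ 2 + (1 - α ^ 2) * x ^ 2) ((1 - α ^ 2) * (2 * x)) x := by
        have := (((hasDerivAt_id x).pow 2).const_mul (1 - α ^ 2)).const_add (α ^ 2)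
        refine this.congr_deriv ?_
        simp
      have hout := HasDerivAt.comp (h₂ := biasEntropy) x
        (hasDerivAt_biasEntropy (by linarith [hx.1]) hT1) (hin.sqrt hpos.ne')
      exact (hasDerivAt_biasEntropy (by linarith [hx.1]) hx.2).sub hout
    refine antitoneOn_of_deriv_nonpos (convex_Icc 0 1) ?_ ?_ ?_
    · apply Continuous.continuousOn
      exact continuous_biasEntropy.sub (continuous_biasEntropy.comp (by fun_prop))
    · rw [interior_Icc]
      exact fun x hx => (key x hx).1.differentiableAt.differentiableWithinAt
    · rw [interior_Icc]
      intro x hx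
      obtain ⟨hd, hxT, hT1⟩ := key x hx
      rw [hd.deriv]
      have hT0 := hx.1.trans_le hxT
      have hle := antitoneOn_halfLogRatio_mul hx ⟨hT0, hT1⟩ hxT
      have hx2 : 0 < 1 - x ^ 2 := by nlinarith [hx.1, hx.2]
      have hTsq : √(α ^ 2 + (1 - α ^ 2) * x ^ 2) ^ 2 = α ^ 2 + (1 - α ^ 2) * x ^ 2 :=
        sq_sqrt (by positivity)
      set T := √(α ^ 2 + (1 - α ^ 2) * x ^ 2)
      simp only at hle
      -- This factorization turns the wanted sign of the derivative, (1 - α²) artanh(T)/T ≤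
      -- artanh(x)/x, into the comparison of (1 - y²) artanh(y)/y at y = T and y = x ≤ T.
      have h1T : 1 - T ^ 2 = (1 - α ^ 2) * (1 - x ^ 2) := by rw [hTsq]; ring
      rw [h1T, div_le_div_iff₀ hT0 hx.1] at hle
      have hle' : (1 - α ^ 2) * halfLogRatio T * x ≤ halfLogRatio x * T := by
        refine le_of_mul_le_mul_left ?_ hx2
        linarith
      have : halfLogRatio T * ((1 - α ^ 2) * (2 * x) / (2 * T)) ≤ halfLogRatio x := by
        rw [← mul_div_assoc, div_le_iff₀ (by positivity)]
        linarith
      linarith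
  have := hanti ⟨le_rfl, zero_le_one⟩ ⟨hx0, hx1⟩ hx0
  simp only at this
  rwa [biasEntropy_zero, show α ^ 2 + (1 - α ^ 2) * 0 ^ 2 = α ^ 2 by ring, sqrt_sq hα0] at this

/-! ### Entropy of two eigenvalues with prescribed sum -/

/-- The entropy (in nats) contributed by a pair of eigenvalues with sum `w` and difference `t`. -/
def pairEntropy (w t : ℝ) : ℝ := negMulLog ((w + t) / 2) + negMulLog ((w - t) / 2)

theorem pairEntropy_add_sub (a b : ℝ) : pairEntropy (a + b) (a - b) = negMulLog a + negMulLog b := by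
  unfold pairEntropy; congr 2 <;> ring

theorem pairEntropy_zero_right (w : ℝ) : pairEntropy w 0 = 2 * negMulLog (w / 2) := by
  simp [pairEntropy, two_mul]

theorem pairEntropy_mul (w x : ℝ) : pairEntropy w (w * x) = negMulLog w + w * biasEntropy x := by
  rw [pairEntropy, biasEntropy, binEntropy_eq_negMulLog_add_negMulLog_one_sub,
    show (w + w * x) / 2 = w * ((1 + x) / 2) by ring,
    show (w - w * x) / 2 = w * (1 - (1 + x) / 2) by ring, negMulLog_mul, negMulLog_mul]
  ring

theorem pairEntropy_antitoneOn {w : ℝ} (hw : 0 ≤ w) :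
    AntitoneOn (pairEntropy w) (Set.Icc 0 w) := by
  rcases hw.eq_or_lt with rfl | hw
  · intro x hx y hy _
    rw [le_antisymm hx.2 hx.1, le_antisymm hy.2 hy.1]
  intro x hx y hy hxy
  have h : ∀ z, pairEntropy w z = negMulLog w + w * biasEntropy (z / w) := by
    intro z
    rw [← pairEntropy_mul, mul_div_cancel₀ _ hw.ne']
  rw [h, h]
  have hm : ∀ z ∈ Set.Icc 0 w, z / w ∈ Set.Icc (0 : ℝ) 1 := fun z hz =>
    ⟨div_nonneg hz.1 hw.le, div_le_one_of_le₀ hz.2 hw.le⟩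
  have := biasEntropy_antitoneOn (hm x hx) (hm y hy) (by gcongr)
  gcongr

/-- This is `biasEntropy_sub_le` scaled by a + b, with α = |a - b|/(a + b), because 4ab/(a + b)² = 1
- α². In the application a and b are the two flip weights of a coset and x is twice the real part of
the off-diagonal entry of the input; the left side dominates output entropy minus environment
entropy. -/
theorem pairEntropy_sub_le {a b x : ℝ} (ha : 0 ≤ a) (hb : 0 ≤ b) (hx : |x| ≤ 1) :
    pairEntropy (a + b) ((a + b) * |x|) - pairEntropy (a + b) (√((a - b) ^ 2 + 4 * (a * b) * x ^ 2))
      ≤ 2 * negMulLog ((a + b) / 2) - (negMulLog a + negMulLog b) := by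
  rcases (add_nonneg ha hb).eq_or_lt with hw | hw
  · have ha' : a = 0 := by linarith
    have hb' : b = 0 := by linarith
    simp [ha', hb']
  set w := a + b with hwdef
  have hα1 : |a - b| / w ≤ 1 := by
    rw [div_le_one hw, abs_le]; constructor <;> linarith
  have key := biasEntropy_sub_le (α := |a - b| / w) (by positivity) hα1 (abs_nonneg x) hx
  have h1 : √((a - b) ^ 2 + 4 * (a * b) * x ^ 2) =
      w * √((|a - b| / w) ^ 2 + (1 - (|a - b| / w) ^ 2) * |x| ^ 2) := by
    rw [← sqrt_sq hw.le, ← sqrt_mul (sq_nonneg _)]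
    congr 1
    rw [sqrt_sq hw.le, div_pow, sq_abs, sq_abs]
    field_simp
    rw [hwdef]
    ring
  have h2 : negMulLog a + negMulLog b = negMulLog w + w * biasEntropy (|a - b| / w) := by
    rw [← pairEntropy_mul, mul_div_cancel₀ _ hw.ne', hwdef, ← pairEntropy_add_sub]
    rcases abs_choice (a - b) with h | h <;> rw [h]
    unfold pairEntropy
    rw [add_comm]
    congr 2
    ring
  have h3 : 2 * negMulLog (w / 2) = negMulLog w + w * log 2 := by
    rw [← pairEntropy_zero_right, ← biasEntropy_zero, ← pairEntropy_mul, mul_zero]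
  rw [h1, h2, h3, pairEntropy_mul, pairEntropy_mul]
  nlinarith

/-! ### Inequalities for `negMulLog` -/

theorem two_mul_negMulLog_half (w : ℝ) : 2 * negMulLog (w / 2) = negMulLog w + w * log 2 := by
  rw [← pairEntropy_zero_right, ← biasEntropy_zero, ← pairEntropy_mul, mul_zero]

theorem negMulLog_add_le {a b : ℝ} (ha : 0 ≤ a) (hb : 0 ≤ b) :
    negMulLog a + negMulLog b ≤ 2 * negMulLog ((a + b) / 2) := by
  have := concaveOn_negMulLog.2 (Set.mem_Ici.2 ha) (Set.mem_Ici.2 hb)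
    (by norm_num : (0 : ℝ) ≤ 1 / 2) (by norm_num : (0 : ℝ) ≤ 1 / 2) (by norm_num)
  simp only [smul_eq_mul] at this
  rw [show 1 / 2 * a + 1 / 2 * b = (a + b) / 2 by ring] at this
  linarith

theorem negMulLog_add_le_add {a b : ℝ} (ha : 0 ≤ a) (hb : 0 ≤ b) :
    negMulLog (a + b) ≤ negMulLog a + negMulLog b := by
  rcases ha.eq_or_lt with rfl | ha'
  · simp
  rcases hb.eq_or_lt with rfl | hb'
  · simp
  simp only [negMulLog]
  have h1 : log a ≤ log (a + b) := log_le_log ha' (by linarith)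
  have h2 : log b ≤ log (a + b) := log_le_log hb' (by linarith)
  nlinarith

/-- The left side is a conditional entropy, bounded here by a Bhattacharyya coefficient. Applying
log y ≤ y - 1 to y = √((a+b)/a) and to y = √((a+b)/b) gives 2st - 2s² with s = √(a+b) and t = √a +
√b, and this is at most t² - s² = 2√(ab). -/
theorem negMulLog_add_sub_le {a b : ℝ} (ha : 0 ≤ a) (hb : 0 ≤ b) :
    negMulLog a + negMulLog b - negMulLog (a + b) ≤ 2 * √(a * b) := by
  have key : ∀ {a b : ℝ}, 0 ≤ a → 0 ≤ b →
      a * (log (a + b) - log a) ≤ 2 * (√a * √(a + b)) - 2 * a := by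
    intro a b ha hb
    rcases ha.eq_or_lt with rfl | ha'
    · simp
    have hr : 0 < (a + b) / a := by positivity
    have h := log_le_sub_one_of_pos (sqrt_pos.mpr hr)
    rw [log_sqrt hr.le, log_div (by linarith) (by linarith)] at h
    have h2 : √a * √(a + b) = a * √((a + b) / a) := by
      rw [sqrt_div (by linarith)]
      field_simp
      rw [sq_sqrt ha]
    rw [h2]
    nlinarith
  have h1 := key ha hb
  have h2 := key hb ha
  rw [add_comm b a] at h2
  simp only [negMulLog]
  have hs : √(a + b) ^ 2 = a + b := sq_sqrt (by linarith)
  have hsa : √a ^ 2 = a := sq_sqrt ha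
  have hsb : √b ^ 2 = b := sq_sqrt hb
  rw [sqrt_mul ha]
  nlinarith [sq_nonneg (√(a + b) - (√a + √b))]

/-! ### Von Neumann entropy through the characteristic polynomial -/

section Spectral

open Polynomial

variable {a b ι S : Type*} [Fintype a] [DecidableEq a] [Fintype b] [DecidableEq b]
  [DecidableEq ι] [Fintype S] [DecidableEq S]

/-- The sum of `-Re z log₂ (Re z)` over the roots `z` of a polynomial. -/
def rootEntropy (p : ℂ[X]) : ℝ := (p.roots.map fun z => negMulLog z.re).sum / log 2

theorem rootEntropy_mul {p q : ℂ[X]} (hp : p ≠ 0) (hq : q ≠ 0) :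
    rootEntropy (p * q) = rootEntropy p + rootEntropy q := by
  rw [rootEntropy, roots_mul (mul_ne_zero hp hq), Multiset.map_add, Multiset.sum_add, add_div,
    rootEntropy, rootEntropy]

theorem rootEntropy_X_pow (n : ℕ) : rootEntropy (X ^ n) = 0 := by
  simp [rootEntropy, Multiset.map_nsmul, Multiset.sum_nsmul]

theorem rootEntropy_one : rootEntropy 1 = 0 := by
  simp [rootEntropy]

theorem rootEntropy_X_sub_C (z : ℂ) : rootEntropy (X - C z) = negMulLog z.re / log 2 := by
  simp [rootEntropy]

theorem rootEntropy_prod (s : Finset ι) (p : ι → ℂ[X]) (hp : ∀ i, p i ≠ 0) :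
    rootEntropy (∏ i ∈ s, p i) = ∑ i ∈ s, rootEntropy (p i) := by
  induction s using Finset.induction_on with
  | empty => simp [rootEntropy_one]
  | insert i s hi ih =>
    rw [Finset.prod_insert hi, Finset.sum_insert hi,
      rootEntropy_mul (hp i) (Finset.prod_ne_zero_iff.2 fun j _ => hp j), ih]

/-- The entropy of the eigenvalues of a matrix, computed from its characteristic polynomial. -/
def spectralEntropy (M : Matrix a a ℂ) : ℝ := rootEntropy M.charpoly

theorem vonNeumannEntropy_eq_spectralEntropy {M : Matrix a a ℂ} (hM : M.IsHermitian) :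
    vonNeumannEntropy M = spectralEntropy M := by
  rw [vonNeumannEntropy, dif_pos hM, spectralEntropy, rootEntropy, hM.roots_charpoly_eq_eigenvalues,
    shannonEntropy, ← Finset.sum_div, Multiset.map_map]
  simp

/-- The two characteristic polynomials differ by a power of X, and zero roots carry no entropy.
Rectangular factors are allowed, which serves both isometries and Gram matrices. -/
theorem spectralEntropy_mul_comm (A : Matrix a b ℂ) (B : Matrix b a ℂ) :
    spectralEntropy (A * B) = spectralEntropy (B * A) := by
  have h := congrArg rootEntropy (Matrix.charpoly_mul_comm' A B)
  rwa [rootEntropy_mul (pow_ne_zero _ X_ne_zero) (Matrix.charpoly_monic _).ne_zero,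
    rootEntropy_mul (pow_ne_zero _ X_ne_zero) (Matrix.charpoly_monic _).ne_zero,
    rootEntropy_X_pow, rootEntropy_X_pow, zero_add, zero_add] at h

theorem spectralEntropy_isometry {V : Matrix a b ℂ} (hV : Vᴴ * V = 1) (B : Matrix b b ℂ) :
    spectralEntropy (V * B * Vᴴ) = spectralEntropy B := by
  rw [spectralEntropy_mul_comm, ← Matrix.mul_assoc, hV, Matrix.one_mul]

theorem spectralEntropy_diagonal (d : a → ℝ) :
    spectralEntropy (Matrix.diagonal fun x => (d x : ℂ)) = shannonEntropy d := by
  rw [spectralEntropy, Matrix.charpoly_diagonal, rootEntropy_prod _ _ fun i => X_sub_C_ne_zero _,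
    shannonEntropy]
  simp [rootEntropy_X_sub_C]

theorem charpoly_blockDiagonal (M : S → Matrix a a ℂ) :
    (Matrix.blockDiagonal M).charpoly = ∏ s, (M s).charpoly := by
  simp only [Matrix.charpoly]
  rw [← Matrix.det_blockDiagonal]
  congr 1
  ext ⟨i, s⟩ ⟨j, t⟩
  by_cases hst : s = t
  · subst hst
    by_cases hij : i = j
    · subst hij; simp [Matrix.blockDiagonal_apply]
    · simp [Matrix.blockDiagonal_apply, hij]
  · simp [Matrix.blockDiagonal_apply, hst]

theorem spectralEntropy_blockDiagonal (M : S → Matrix a a ℂ) :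
    spectralEntropy (Matrix.blockDiagonal M) = ∑ s, spectralEntropy (M s) := by
  rw [spectralEntropy, charpoly_blockDiagonal,
    rootEntropy_prod _ _ fun s => (Matrix.charpoly_monic _).ne_zero]
  rfl

theorem spectralEntropy_fin_two (M : Matrix (Fin 2) (Fin 2) ℂ) {w t : ℝ}
    (hw : M.trace = w) (ht : M.trace ^ 2 - 4 * M.det = (t : ℂ) ^ 2) :
    spectralEntropy M = pairEntropy w t / log 2 := by
  have h : M.charpoly = (X - C (((w + t) / 2 : ℝ) : ℂ)) * (X - C (((w - t) / 2 : ℝ) : ℂ)) := by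
    have hd : M.det = (((w + t) / 2 : ℝ) : ℂ) * (((w - t) / 2 : ℝ) : ℂ) := by
      rw [hw] at ht
      push_cast
      linear_combination -ht / 4
    have hw' : M.trace = (((w + t) / 2 : ℝ) : ℂ) + (((w - t) / 2 : ℝ) : ℂ) := by
      rw [hw]; push_cast; ring
    rw [Matrix.charpoly_fin_two, hd, hw', C_mul, C_add]
    ring
  rw [spectralEntropy, h, rootEntropy_mul (X_sub_C_ne_zero _) (X_sub_C_ne_zero _),
    rootEntropy_X_sub_C, rootEntropy_X_sub_C, Complex.ofReal_re, Complex.ofReal_re, pairEntropy,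
    ← add_div]

end Spectral

/-! ### Coherent information of random bit-flip channels with side information -/

section Kraus

variable {a b r κ : Type*} [Fintype a] [DecidableEq a] [Fintype b] [DecidableEq b]
  [Fintype r] [DecidableEq r] [Fintype κ] [DecidableEq κ]

theorem krausMap_apply (K : κ → Matrix b a ℂ) (ρ : Matrix a a ℂ) :
    krausMap K ρ = ∑ k, K k * ρ * (K k)ᴴ := rfl

theorem isHermitian_krausMap (K : κ → Matrix b a ℂ) {ρ : Matrix a a ℂ} (hρ : ρ.IsHermitian) :
    (krausMap K ρ).IsHermitian := by
  rw [krausMap_apply, Matrix.IsHermitian, Matrix.conjTranspose_sum]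
  refine Finset.sum_congr rfl fun k _ => ?_
  simp [Matrix.mul_assoc, hρ.eq]

/-- The image of a bipartite vector under an operation element acting on the first factor. -/
def actLeft (L : Matrix b a ℂ) (ψ : a × r → ℂ) : b × r → ℂ := fun v => ∑ y, L v.1 y * ψ (y, v.2)

theorem applyLeft_krausMap_vecMulVec (K : κ → Matrix b a ℂ) (ψ ψ' : a × r → ℂ) :
    applyLeft (krausMap K) (Matrix.vecMulVec ψ (star ψ')) =
      ∑ k, Matrix.vecMulVec (actLeft (K k) ψ) (star (actLeft (K k) ψ')) := by
  ext v w
  simp only [applyLeft, LinearMap.coe_mk, AddHom.coe_mk, krausMap_apply, Matrix.of_apply,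
    Matrix.sum_apply, Matrix.vecMulVec_apply, Pi.star_apply, actLeft]
  refine Finset.sum_congr rfl fun k _ => ?_
  simp only [Matrix.mul_apply, Matrix.of_apply, Matrix.conjTranspose_apply, star_sum, star_mul',
    Finset.sum_mul, Finset.mul_sum]
  refine Finset.sum_congr rfl fun y _ => Finset.sum_congr rfl fun y' _ => ?_
  ring

theorem sum_vecMulVec_eq_mul (χ : κ → a → ℂ) :
    ∑ k, Matrix.vecMulVec (χ k) (star (χ k)) =
      (Matrix.of fun v k => χ k v) * (Matrix.of fun v k => χ k v)ᴴ := by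
  ext v w
  simp [Matrix.sum_apply, Matrix.mul_apply, Matrix.vecMulVec_apply]

/-- The entropy of the output and reference is the entropy of the Gram matrix of the operation
elements. -/
theorem vonNeumannEntropy_applyLeft_proj (K : κ → Matrix b a ℂ) {ρ : Matrix a a ℂ}
    (ψ : a × r → ℂ) (hψ : ∀ y y', ∑ z, ψ (y, z) * star (ψ (y', z)) = ρ y y') :
    vonNeumannEntropy (applyLeft (krausMap K) (proj ψ)) =
      spectralEntropy (Matrix.of fun k k' => ((K k)ᴴ * K k' * ρ).trace) := by
  rw [proj, applyLeft_krausMap_vecMulVec, sum_vecMulVec_eq_mul,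
    vonNeumannEntropy_eq_spectralEntropy (Matrix.isHermitian_mul_conjTranspose_self _),
    spectralEntropy_mul_comm]
  congr 1
  ext k k'
  -- Reshaped as a matrix, ψ satisfies ΨΨᴴ = ρ, and the Gram entries are traces of (KΨ)ᴴ(K'Ψ); so
  -- the choice of purification does not matter.
  set Ψ : Matrix a r ℂ := Matrix.of fun y z => ψ (y, z) with hΨ
  have hρ : ρ = Ψ * Ψᴴ := by
    ext y y'
    simp [hΨ, Matrix.mul_apply, ← hψ]
  have hact : ∀ k v, actLeft (K k) ψ v = (K k * Ψ) v.1 v.2 := fun k v => by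
    simp [actLeft, hΨ, Matrix.mul_apply]
  calc _ = ((K k * Ψ)ᴴ * (K k' * Ψ)).trace := by
        simp only [Matrix.mul_apply (M := (Matrix.of _)ᴴ), Matrix.of_apply,
          Matrix.conjTranspose_apply, hact, Matrix.trace, Matrix.diag,
          Matrix.mul_apply (M := (K k * Ψ)ᴴ), Fintype.sum_prod_type]
        rw [Finset.sum_comm]
    _ = _ := by
        rw [Matrix.of_apply, hρ, Matrix.conjTranspose_mul, Matrix.mul_assoc, Matrix.trace_mul_comm]
        simp only [Matrix.mul_assoc]

/-- Tracing out the reference kills the cross terms by orthonormality of the eigenvectors.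
Positivity is needed so that the square roots of the eigenvalues square back. -/
theorem sum_purification_mul_star {ρ : Matrix a a ℂ} (hρ : ρ.PosSemidef) (y y' : a) :
    ∑ z, purification hρ.isHermitian (y, z) * star (purification hρ.isHermitian (y', z)) = ρ y y' := by
  have horth : ∀ i j, ∑ z, hρ.isHermitian.eigenvectorBasis i z * star (hρ.isHermitian.eigenvectorBasis j z) =
      if i = j then 1 else 0 := by
    intro i j
    have := orthonormal_iff_ite.1 hρ.isHermitian.eigenvectorBasis.orthonormal j i
    simp only [PiLp.inner_apply, RCLike.inner_apply, eq_comm (a := j)] at this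
    rw [← this]
    rfl
  have hspec : ρ y y' = ∑ i, (hρ.isHermitian.eigenvalues i : ℂ) * hρ.isHermitian.eigenvectorBasis i y *
      star (hρ.isHermitian.eigenvectorBasis i y') := by
    conv_lhs => rw [hρ.isHermitian.spectral_theorem]
    simp [Unitary.conjStarAlgAut_apply, Matrix.mul_apply, Matrix.diagonal_apply, Matrix.star_apply,
      mul_comm]
  rw [hspec]
  simp only [purification, star_sum, star_mul', Finset.sum_mul_sum]
  rw [Finset.sum_comm]
  refine Finset.sum_congr rfl fun i _ => ?_
  rw [Finset.sum_comm, Finset.sum_eq_single i]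
  · have h1 : (√(hρ.isHermitian.eigenvalues i) : ℂ) * star (√(hρ.isHermitian.eigenvalues i) : ℂ) =
        hρ.isHermitian.eigenvalues i := by
      rw [Complex.star_def, Complex.conj_ofReal, ← Complex.ofReal_mul,
        mul_self_sqrt (hρ.eigenvalues_nonneg i)]
    have h2 := horth i i
    rw [if_pos rfl] at h2
    calc _ = ((√(hρ.isHermitian.eigenvalues i) : ℂ) * star (√(hρ.isHermitian.eigenvalues i) : ℂ)) *
          hρ.isHermitian.eigenvectorBasis i y * star (hρ.isHermitian.eigenvectorBasis i y') *
          ∑ z, hρ.isHermitian.eigenvectorBasis i z * star (hρ.isHermitian.eigenvectorBasis i z) := by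
          rw [Finset.mul_sum]
          exact Finset.sum_congr rfl fun z _ => by ring
      _ = _ := by rw [h1, h2, mul_one]
  · intro j _ hj
    have h2 := horth i j
    rw [if_neg hj.symm] at h2
    calc _ = (√(hρ.isHermitian.eigenvalues i) : ℂ) * star (√(hρ.isHermitian.eigenvalues j) : ℂ) *
          hρ.isHermitian.eigenvectorBasis i y * star (hρ.isHermitian.eigenvectorBasis j y') *
          ∑ z, hρ.isHermitian.eigenvectorBasis i z * star (hρ.isHermitian.eigenvectorBasis j z) := by
          rw [Finset.mul_sum]
          exact Finset.sum_congr rfl fun z _ => by ring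
      _ = _ := by rw [h2, mul_zero]
  · simp

end Kraus

theorem fin_two_add_self (x : Fin 2) : x + x = 0 := by revert x; decide

/-- The unitary matrix whose columns are the basis vectors. -/
def basisMatrix (e : QubitBasis) : Matrix (Fin 2) (Fin 2) ℂ := Matrix.of fun y x => ket e x y

theorem sum_star_ket_mul_ket (e : QubitBasis) (x x' : Fin 2) :
    ∑ y, star (ket e x y) * ket e x' y = if x = x' then 1 else 0 := by
  have := orthonormal_iff_ite.1 e.orthonormal x x'
  simp only [PiLp.inner_apply, RCLike.inner_apply] at this
  rw [← this]
  exact Finset.sum_congr rfl fun y _ => mul_comm _ _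

theorem basisMatrix_conjTranspose_mul (e : QubitBasis) : (basisMatrix e)ᴴ * basisMatrix e = 1 := by
  ext x x'
  simp only [Matrix.mul_apply, basisMatrix, Matrix.conjTranspose_apply, Matrix.of_apply,
    Matrix.one_apply]
  exact sum_star_ket_mul_ket e x x'

theorem basisMatrix_mul_conjTranspose (e : QubitBasis) : basisMatrix e * (basisMatrix e)ᴴ = 1 :=
  mul_eq_one_comm.1 (basisMatrix_conjTranspose_mul e)

/-! ### Bit flips with a classical label: blocks of the output and of the environment -/

section Shift

variable {b S : Type*} [Fintype b] [DecidableEq b] [Fintype S] [DecidableEq S]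

/-- The operator `√q(z,s) ∑ₓ |z + x, s⟩⟨x|`. -/
def shiftMatrix (q : Fin 2 × S → ℝ) (c : Fin 2 × S) : Matrix (Fin 2 × S) (Fin 2) ℂ :=
  Matrix.of fun d x => if d = (c.1 + x, c.2) then (√(q c) : ℂ) else 0

/-- The operation elements `√q(c) ∑ₓ |φ_{c+x}⟩⟨eₓ|`, where `φ` consists of the columns of `V`. -/
def shiftElement (V : Matrix b (Fin 2 × S) ℂ) (e : QubitBasis) (q : Fin 2 × S → ℝ)
    (c : Fin 2 × S) : Matrix b (Fin 2) ℂ :=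
  V * shiftMatrix q c * (basisMatrix e)ᴴ

/-- The average of `q` and its shift. -/
def shiftAverage (q : Fin 2 × S → ℝ) (c : Fin 2 × S) : ℝ := (q c + q (c.1 + 1, c.2)) / 2

theorem conjTranspose_mul_shiftMatrix (q : Fin 2 × S → ℝ) (c c' : Fin 2 × S) (x x' : Fin 2) :
    ((shiftMatrix q c)ᴴ * shiftMatrix q c') x x' =
      if (c.1 + x, c.2) = (c'.1 + x', c'.2) then (√(q c) * √(q c') : ℂ) else 0 := by
  simp only [Matrix.mul_apply, Matrix.conjTranspose_apply, shiftMatrix, Matrix.of_apply]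
  rw [Finset.sum_eq_single (c.1 + x, c.2)]
  · simp only [if_true]
    split_ifs <;> simp
  · intro d _ hd
    simp [hd]
  · simp

/-- The block of the channel output at `s`. -/
def outputBlock (q : Fin 2 × S → ℝ) (ρ : Matrix (Fin 2) (Fin 2) ℂ) (s : S) :
    Matrix (Fin 2) (Fin 2) ℂ :=
  Matrix.of fun y y' => ∑ z, (q (z, s) : ℂ) * ρ (y + z) (y' + z)

/-- The block of the Gram matrix at `s`. -/
def gramBlock (q : Fin 2 × S → ℝ) (ρ : Matrix (Fin 2) (Fin 2) ℂ) (s : S) :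
    Matrix (Fin 2) (Fin 2) ℂ :=
  Matrix.of fun z z' => (√(q (z, s)) * √(q (z', s)) : ℂ) * ∑ x, ρ (x + z + z') x

theorem sum_shiftMatrix_mul_mul {q : Fin 2 × S → ℝ} (hq : ∀ c, 0 ≤ q c)
    (ρ : Matrix (Fin 2) (Fin 2) ℂ) :
    ∑ c, shiftMatrix q c * ρ * (shiftMatrix q c)ᴴ = Matrix.blockDiagonal (outputBlock q ρ) := by
  ext ⟨y, s⟩ ⟨y', s'⟩
  have hz : ∀ y z x : Fin 2, y = z + x ↔ x = y + z := by decide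
  simp only [Matrix.sum_apply, Matrix.mul_apply, Matrix.conjTranspose_apply, shiftMatrix,
    Matrix.of_apply, Matrix.blockDiagonal_apply, outputBlock, Fintype.sum_prod_type,
    Prod.mk.injEq, hz]
  have hsq : ∀ c, (√(q c) : ℂ) * (√(q c) : ℂ) = q c := fun c => by
    rw [← Complex.ofReal_mul, mul_self_sqrt (hq c)]
  by_cases hs : s = s'
  · subst hs
    rw [if_pos rfl]
    refine Finset.sum_congr rfl fun z _ => ?_
    rw [Finset.sum_eq_single s]
    · generalize y + z = y1
      generalize y' + z = y2
      rw [← hsq]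
      fin_cases y2 <;> simp <;> fin_cases y1 <;> simp <;> ring
    · intro t _ ht
      simp [ht.symm]
    · simp
  · rw [if_neg hs]
    refine Finset.sum_eq_zero fun z _ => Finset.sum_eq_zero fun t _ => ?_
    by_cases ht : s = t
    · subst ht
      simp [Ne.symm hs]
    · simp [ht]

theorem gram_shiftElement {V : Matrix b (Fin 2 × S) ℂ} (hV : Vᴴ * V = 1) (e : QubitBasis)
    (q : Fin 2 × S → ℝ) (ρ : Matrix (Fin 2) (Fin 2) ℂ) :
    (Matrix.of fun c c' => ((shiftElement V e q c)ᴴ * shiftElement V e q c' * ρ).trace) =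
      Matrix.blockDiagonal (gramBlock q ((basisMatrix e)ᴴ * ρ * basisMatrix e)) := by
  ext ⟨z, s⟩ ⟨z', s'⟩
  set σ := (basisMatrix e)ᴴ * ρ * basisMatrix e
  have h : ((shiftElement V e q (z, s))ᴴ * shiftElement V e q (z', s') * ρ).trace =
      (((shiftMatrix q (z, s))ᴴ * shiftMatrix q (z', s')) * σ).trace := by
    have : (shiftElement V e q (z, s))ᴴ * shiftElement V e q (z', s') * ρ =
        basisMatrix e * ((shiftMatrix q (z, s))ᴴ * ((Vᴴ * V) * (shiftMatrix q (z', s') *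
          ((basisMatrix e)ᴴ * ρ)))) := by
      simp only [shiftElement, Matrix.conjTranspose_mul, Matrix.conjTranspose_conjTranspose,
        Matrix.mul_assoc]
    rw [this, hV, Matrix.one_mul, Matrix.trace_mul_comm]
    simp only [σ, Matrix.mul_assoc]
  have hz : ∀ z z' x x' : Fin 2, z + x = z' + x' ↔ x' = x + z + z' := by decide
  rw [Matrix.of_apply, h, Matrix.trace, Matrix.blockDiagonal_apply]
  simp only [Matrix.diag, Matrix.mul_apply (N := σ), conjTranspose_mul_shiftMatrix, Prod.mk.injEq,
    gramBlock, Matrix.of_apply, hz]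
  by_cases hs : s = s'
  · subst hs
    simp [mul_add]
  · simp [hs]

theorem IsDensity.conj_basisMatrix {ρ : Matrix (Fin 2) (Fin 2) ℂ} (hρ : IsDensity ρ)
    (e : QubitBasis) : IsDensity ((basisMatrix e)ᴴ * ρ * basisMatrix e) := by
  refine ⟨hρ.1.conjTranspose_mul_mul_same _, ?_⟩
  rw [Matrix.trace_mul_comm, ← Matrix.mul_assoc, basisMatrix_mul_conjTranspose, Matrix.one_mul, hρ.2]

/-- Flips change only the bit and keep the label s, so both the output (up to the isometry V) and
the Gram matrix of the operation elements are block diagonal in s, and both entropies are sums over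
s. -/
theorem coherentInfo_shiftElement {V : Matrix b (Fin 2 × S) ℂ} (hV : Vᴴ * V = 1) (e : QubitBasis)
    {q : Fin 2 × S → ℝ} (hq : ∀ c, 0 ≤ q c) {ρ : Matrix (Fin 2) (Fin 2) ℂ} (hρ : IsDensity ρ) :
    coherentInfo ρ (krausMap (shiftElement V e q)) =
      ∑ s, (spectralEntropy (outputBlock q ((basisMatrix e)ᴴ * ρ * basisMatrix e) s) -
        spectralEntropy (gramBlock q ((basisMatrix e)ᴴ * ρ * basisMatrix e) s)) := by
  rw [coherentInfo, dif_pos hρ.1.isHermitian,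
    vonNeumannEntropy_eq_spectralEntropy (isHermitian_krausMap _ hρ.1.isHermitian),
    vonNeumannEntropy_applyLeft_proj _ _ (sum_purification_mul_star hρ.1),
    gram_shiftElement hV, Finset.sum_sub_distrib, ← spectralEntropy_blockDiagonal,
    ← spectralEntropy_blockDiagonal, ← sum_shiftMatrix_mul_mul hq, ← spectralEntropy_isometry hV (∑ c, _),
    krausMap_apply, Matrix.mul_sum, Matrix.sum_mul]
  congr 2
  refine Finset.sum_congr rfl fun c _ => ?_
  simp only [shiftElement, Matrix.conjTranspose_mul, Matrix.conjTranspose_conjTranspose,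
    Matrix.mul_assoc]

/-- The entries of a qubit density operator. -/
theorem IsDensity.exists_entries {ρ : Matrix (Fin 2) (Fin 2) ℂ} (hρ : IsDensity ρ) :
    ∃ α δ u v : ℝ, ρ = !![(α : ℂ), u + v * Complex.I; u - v * Complex.I, (δ : ℂ)] ∧ α + δ = 1 ∧
      u ^ 2 + v ^ 2 ≤ α * δ := by
  have hH := hρ.1.isHermitian
  have h00 : (starRingEnd ℂ) (ρ 0 0) = ρ 0 0 := hH.apply 0 0
  have h11 : (starRingEnd ℂ) (ρ 1 1) = ρ 1 1 := hH.apply 1 1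
  have h10 : (starRingEnd ℂ) (ρ 0 1) = ρ 1 0 := hH.apply 1 0
  have h0 := Complex.conj_eq_iff_re.1 h00
  have h1 := Complex.conj_eq_iff_re.1 h11
  have hρe : ρ = !![((ρ 0 0).re : ℂ), (ρ 0 1).re + (ρ 0 1).im * Complex.I;
      (ρ 0 1).re - (ρ 0 1).im * Complex.I, ((ρ 1 1).re : ℂ)] := by
    ext i j
    fin_cases i <;> fin_cases j
    · exact h0.symm
    · exact (Complex.re_add_im _).symm
    · change ρ 1 0 = (ρ 0 1).re - (ρ 0 1).im * Complex.I
      rw [← h10]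
      apply Complex.ext <;> simp
    · exact h1.symm
  refine ⟨(ρ 0 0).re, (ρ 1 1).re, (ρ 0 1).re, (ρ 0 1).im, hρe, ?_, ?_⟩
  · have := congrArg Complex.re hρ.2
    rwa [Matrix.trace_fin_two] at this
  · have hdet := hρ.1.det_nonneg
    rw [Matrix.det_fin_two, ← h10, ← h0, ← h1, Complex.mul_conj, Complex.normSq_apply] at hdet
    have : (0 : ℝ) ≤ (ρ 0 0).re * (ρ 1 1).re - ((ρ 0 1).re * (ρ 0 1).re + (ρ 0 1).im * (ρ 0 1).im) := by
      exact_mod_cast hdet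
    linarith

theorem spectralEntropy_gramBlock {q : Fin 2 × S → ℝ} (hq : ∀ c, 0 ≤ q c) (α δ u v : ℝ)
    (h : α + δ = 1) (s : S) :
    spectralEntropy (gramBlock q !![(α : ℂ), u + v * Complex.I; u - v * Complex.I, (δ : ℂ)] s) =
      pairEntropy (q (0, s) + q (1, s))
        (√((q (0, s) - q (1, s)) ^ 2 + 4 * (q (0, s) * q (1, s)) * (2 * u) ^ 2)) / log 2 := by
  have hh : (α : ℂ) + δ = 1 := by exact_mod_cast h
  have hsq : ∀ c, (√(q c) : ℂ) ^ 2 = q c := fun c => by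
    rw [← Complex.ofReal_pow, sq_sqrt (hq c)]
  have e00 : gramBlock q !![(α : ℂ), u + v * Complex.I; u - v * Complex.I, (δ : ℂ)] s 0 0 =
      q (0, s) := by
    simp [gramBlock, hh, ← hsq, sq]
  have e11 : gramBlock q !![(α : ℂ), u + v * Complex.I; u - v * Complex.I, (δ : ℂ)] s 1 1 =
      q (1, s) := by
    simp [gramBlock, hh, ← hsq, sq]
  have e01 : gramBlock q !![(α : ℂ), u + v * Complex.I; u - v * Complex.I, (δ : ℂ)] s 0 1 =
      √(q (0, s)) * √(q (1, s)) * (2 * u) := by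
    simp [gramBlock]; left; ring
  have e10 : gramBlock q !![(α : ℂ), u + v * Complex.I; u - v * Complex.I, (δ : ℂ)] s 1 0 =
      √(q (0, s)) * √(q (1, s)) * (2 * u) := by
    simp [gramBlock]; ring
  apply spectralEntropy_fin_two
  · rw [Matrix.trace_fin_two, e00, e11]; push_cast; ring
  · have hnn : 0 ≤ (q (0, s) - q (1, s)) ^ 2 + 4 * (q (0, s) * q (1, s)) * (2 * u) ^ 2 := by
      have := hq (0, s); have := hq (1, s); positivity
    rw [Matrix.trace_fin_two, Matrix.det_fin_two, e00, e11, e01, e10, ← Complex.ofReal_pow,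
      sq_sqrt hnn]
    push_cast
    rw [← hsq, ← hsq]
    ring

theorem spectralEntropy_outputBlock (q : Fin 2 × S → ℝ) (α δ u v : ℝ)
    (h : α + δ = 1) (s : S) :
    spectralEntropy (outputBlock q !![(α : ℂ), u + v * Complex.I; u - v * Complex.I, (δ : ℂ)] s) =
      pairEntropy (q (0, s) + q (1, s))
        (√((q (0, s) - q (1, s)) ^ 2 * ((α - δ) ^ 2 + 4 * v ^ 2) +
          4 * ((q (0, s) + q (1, s)) * u) ^ 2)) / log 2 := by
  have hh : (α : ℂ) + δ = 1 := by exact_mod_cast h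
  apply spectralEntropy_fin_two
  · simp [Matrix.trace_fin_two, outputBlock]
    linear_combination (q (0, s) + q (1, s) : ℂ) * hh
  · rw [← Complex.ofReal_pow, sq_sqrt (by positivity)]
    simp [Matrix.trace_fin_two, Matrix.det_fin_two, outputBlock]
    ring_nf
    simp only [Complex.I_sq]
    ring

/-- The coherent information of a random bit-flip channel with side information is at most the
entropy of the averaged weights minus the entropy of the weights. -/
theorem coherentInfo_shiftElement_le {V : Matrix b (Fin 2 × S) ℂ} (hV : Vᴴ * V = 1)
    (e : QubitBasis) {q : Fin 2 × S → ℝ} (hq : ∀ c, 0 ≤ q c) {ρ : Matrix (Fin 2) (Fin 2) ℂ}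
    (hρ : IsDensity ρ) :
    coherentInfo ρ (krausMap (shiftElement V e q)) ≤
      shannonEntropy (shiftAverage q) - shannonEntropy q := by
  rw [coherentInfo_shiftElement hV e hq hρ]
  obtain ⟨α, δ, u, v, h, htr, hdet⟩ := (hρ.conj_basisMatrix e).exists_entries
  rw [h, shannonEntropy, shannonEntropy, Fintype.sum_prod_type_right, Fintype.sum_prod_type_right,
    ← Finset.sum_sub_distrib]
  refine Finset.sum_le_sum fun s _ => ?_
  rw [spectralEntropy_outputBlock _ _ _ _ _ htr, spectralEntropy_gramBlock hq _ _ _ _ htr]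
  simp only [Fin.sum_univ_two, shiftAverage]
  rw [show ((0 : Fin 2) + 1, s) = (1, s) from rfl, show ((1 : Fin 2) + 1, s) = (0, s) from rfl,
    add_comm (q (1, s)), ← add_div, ← add_div, ← sub_div, ← sub_div]
  have h0 := hq (0, s)
  have h1 := hq (1, s)
  set a := q (0, s)
  set c := q (1, s)
  -- Positivity of the input bounds u² + v² by αδ, and α + δ = 1 gives αδ ≤ 1/4.
  have hu : 4 * (u ^ 2 + v ^ 2) ≤ 1 := by nlinarith [sq_nonneg (α - δ)]
  have hαδ : (α - δ) ^ 2 = 1 - 4 * (α * δ) := by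
    have : δ = 1 - α := by linarith
    rw [this]; ring
  have hx : |2 * u| ≤ 1 := by
    rw [abs_le_one_iff_mul_self_le_one]; nlinarith [sq_nonneg v]
  have hlog : 0 ≤ log 2 := log_nonneg (by norm_num)
  refine div_le_div_of_nonneg_right ?_ hlog
  -- Dropping the first summand of the discriminant brings the two output eigenvalues closer and so
  -- can only raise the output entropy. The environment block depends on the input only through u,
  -- so one parameter x = 2u remains.
  have hmono : pairEntropy (a + c) (√((a - c) ^ 2 * ((α - δ) ^ 2 + 4 * v ^ 2) +
      4 * ((a + c) * u) ^ 2)) ≤ pairEntropy (a + c) ((a + c) * |2 * u|) := by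
    have hw : 0 ≤ a + c := add_nonneg h0 h1
    apply pairEntropy_antitoneOn hw
    · exact ⟨by positivity, mul_le_of_le_one_right hw hx⟩
    · refine ⟨sqrt_nonneg _, ?_⟩
      rw [sqrt_le_left hw]
      have h2 : (a - c) ^ 2 ≤ (a + c) ^ 2 := by nlinarith [mul_nonneg h0 h1]
      have h3 : (α - δ) ^ 2 + 4 * v ^ 2 ≤ 1 - 4 * u ^ 2 := by rw [hαδ]; linarith
      have h4 : 0 ≤ (α - δ) ^ 2 + 4 * v ^ 2 := by positivity
      nlinarith [mul_le_mul h2 h3 h4 (sq_nonneg _)]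
    · apply le_sqrt_of_sq_le
      rw [mul_pow, sq_abs]
      nlinarith [mul_nonneg (sq_nonneg (a - c)) (by positivity : 0 ≤ (α - δ) ^ 2 + 4 * v ^ 2)]
  have := pairEntropy_sub_le h0 h1 hx
  linarith

theorem isDensity_completelyMixed : IsDensity completelyMixed := by
  refine ⟨Matrix.PosSemidef.one.smul (by rw [Complex.nonneg_iff]; norm_num), ?_⟩
  simp [completelyMixed]

theorem coherentInfo_shiftElement_completelyMixed {V : Matrix b (Fin 2 × S) ℂ} (hV : Vᴴ * V = 1)
    (e : QubitBasis) {q : Fin 2 × S → ℝ} (hq : ∀ c, 0 ≤ q c) :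
    coherentInfo completelyMixed (krausMap (shiftElement V e q)) =
      shannonEntropy (shiftAverage q) - shannonEntropy q := by
  rw [coherentInfo_shiftElement hV e hq isDensity_completelyMixed]
  have h : (basisMatrix e)ᴴ * completelyMixed * basisMatrix e =
      !![((1 / 2 : ℝ) : ℂ), (0 : ℝ) + (0 : ℝ) * Complex.I;
        (0 : ℝ) - (0 : ℝ) * Complex.I, ((1 / 2 : ℝ) : ℂ)] := by
    rw [completelyMixed, Matrix.mul_smul, Matrix.mul_one, Matrix.smul_mul,
      basisMatrix_conjTranspose_mul]
    ext i j
    fin_cases i <;> fin_cases j <;> simp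
  rw [h, shannonEntropy, shannonEntropy, Fintype.sum_prod_type_right, Fintype.sum_prod_type_right,
    ← Finset.sum_sub_distrib]
  refine Finset.sum_congr rfl fun s _ => ?_
  rw [spectralEntropy_outputBlock _ _ _ _ _ (by norm_num),
    spectralEntropy_gramBlock hq _ _ _ _ (by norm_num)]
  simp only [Fin.sum_univ_two, shiftAverage]
  rw [show ((0 : Fin 2) + 1, s) = (1, s) from rfl, show ((1 : Fin 2) + 1, s) = (0, s) from rfl,
    add_comm (q (1, s)), ← add_div, ← add_div, ← two_mul, ← pairEntropy_zero_right]
  -- At u = v = 0 and α = δ the environment block is diagonal with the two weights as eigenvalues;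
  -- the sign of their difference is immaterial.
  have h1 : ∀ t, |t| = q (0, s) - q (1, s) ∨ |t| = -(q (0, s) - q (1, s)) →
      pairEntropy (q (0, s) + q (1, s)) |t| = negMulLog (q (0, s)) + negMulLog (q (1, s)) := by
    rintro t (h | h) <;> rw [h]
    · exact pairEntropy_add_sub _ _
    · rw [neg_sub, add_comm (q (0, s)), pairEntropy_add_sub, add_comm]
  norm_num [sqrt_sq_eq_abs]
  rw [h1 _ (abs_choice _)]

end Shift

/-- If the coherent information is bounded by its value at the completely mixed state, the maximum
single-letter coherent information is this value. -/
theorem isMaxOn_and_mslci_eq {b : Type*} [Fintype b] [DecidableEq b]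
    {Φ : Matrix (Fin 2) (Fin 2) ℂ →ₗ[ℂ] Matrix b b ℂ}
    (h : ∀ ρ, IsDensity ρ → coherentInfo ρ Φ ≤ coherentInfo completelyMixed Φ) :
    IsMaxOn (fun ρ => coherentInfo ρ Φ) {ρ | IsDensity ρ} completelyMixed ∧
      mslci Φ = coherentInfo completelyMixed Φ := by
  refine ⟨h, IsGreatest.csSup_eq ⟨⟨_, isDensity_completelyMixed, rfl⟩, ?_⟩⟩
  rintro _ ⟨ρ, hρ, rfl⟩
  exact h ρ hρ

/-! ### The encoding circuit and the tail distributions -/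

theorem bits_add_self {N : ℕ} (c : Bits N) : c + c = 0 := by
  funext j; exact fin_two_add_self (c j)

theorem bits_add_add_cancel {N : ℕ} (c d : Bits N) : c + d + d = c := by
  rw [add_assoc, bits_add_self, add_zero]

theorem div_two_lt {n k : ℕ} (h : k < 2 ^ (n + 1)) : k / 2 < 2 ^ n := by
  rw [pow_succ] at h; omega

section Halves

variable {n : ℕ}

/-- Splitting a string into its first and its second half. -/
def halves : Bits (2 ^ (n + 1)) ≃ Bits (2 ^ n) × Bits (2 ^ n) where
  toFun c := (fun j => c ⟨j, lt_of_lt_half j.2⟩, fun j => c ⟨2 ^ n + j, add_half_lt j.2⟩)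
  invFun p k := if h : (k : ℕ) < 2 ^ n then p.1 ⟨k, h⟩ else p.2 ⟨k - 2 ^ n, sub_half_lt k.2 h⟩
  left_inv c := by
    funext k
    by_cases h : (k : ℕ) < 2 ^ n
    · simp [h]
    · simp only [h, dif_neg, not_false_eq_true]
      congr 1
      ext
      simp only
      omega
  right_inv p := by
    ext j
    · simp
    · simp

/-- The two strings on which the encoding of half the length acts: the sums of the pairs
`(u_{2j}, u_{2j+1})`, and the second entries of the pairs. -/
def pairing : Bits (2 ^ (n + 1)) ≃ Bits (2 ^ n) × Bits (2 ^ n) where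
  toFun u := (fun j => u ⟨2 * j, double_lt j.2⟩ + u ⟨2 * j + 1, double_succ_lt j.2⟩,
    fun j => u ⟨2 * j + 1, double_succ_lt j.2⟩)
  invFun p k :=
    if (k : ℕ) % 2 = 0 then
      p.1 ⟨k / 2, div_two_lt k.2⟩ +
        p.2 ⟨k / 2, div_two_lt k.2⟩
    else p.2 ⟨k / 2, div_two_lt k.2⟩
  left_inv u := by
    funext k
    rcases Nat.mod_two_eq_zero_or_one k with h | h
    · have h2 : 2 * ((k : ℕ) / 2) = k := by omega
      simp only [h, if_true, h2]
      rw [add_assoc, fin_two_add_self, add_zero]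
    · have h2 : 2 * ((k : ℕ) / 2) + 1 = k := by omega
      simp [h, h2]
  right_inv p := by
    have h2 : ∀ j : ℕ, (2 * j + 1) / 2 = j := by omega
    ext j
    · simp [h2, Nat.add_mod, add_assoc, fin_two_add_self]
    · simp [h2, Nat.add_mod]

/-- The CNOT layer and the reverse shuffle together are the bijection `pairing`. In this form
linearity, injectivity and the product structure follow by induction. -/
theorem encode_succ (u : Bits (2 ^ (n + 1))) :
    encode (n + 1) u = halves.symm (encode n (pairing u).1, encode n (pairing u).2) := by
  have h1 : (fun j : Fin (2 ^ n) => reverseShuffle (cnotLayer u) ⟨j, lt_of_lt_half j.2⟩) =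
      (pairing u).1 := by
    funext j
    simp [reverseShuffle, cnotLayer, pairing]
  have h2 : (fun j : Fin (2 ^ n) => reverseShuffle (cnotLayer u) ⟨2 ^ n + j, add_half_lt j.2⟩) =
      (pairing u).2 := by
    funext j
    simp [reverseShuffle, cnotLayer, pairing, Nat.add_mod]
  funext k
  rw [encode, h1, h2]
  rfl

theorem pairing_add (u v : Bits (2 ^ (n + 1))) : pairing (u + v) = pairing u + pairing v := by
  ext j
  · simp only [pairing, Equiv.coe_fn_mk, Pi.add_apply, Prod.fst_add]
    rw [add_add_add_comm]
  · rfl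

theorem halves_add (u v : Bits (2 ^ (n + 1))) : halves (u + v) = halves u + halves v := rfl

theorem halves_symm_add (p q : Bits (2 ^ n) × Bits (2 ^ n)) :
    halves.symm (p + q) = halves.symm p + halves.symm q := by
  apply halves.injective
  rw [halves_add]
  simp

theorem prod_halves {M : Type*} [CommMonoid M] (f : Fin 2 → M) (c : Bits (2 ^ (n + 1))) :
    ∏ j, f (c j) = (∏ j, f ((halves c).1 j)) * ∏ j, f ((halves c).2 j) := by
  have h : 2 ^ n + 2 ^ n = 2 ^ (n + 1) := by rw [pow_succ]; omega
  rw [← Equiv.prod_comp (finCongr h), Fin.prod_univ_add]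
  rfl

end Halves

theorem encode_add : ∀ (n : ℕ) (u v : Bits (2 ^ n)), encode n (u + v) = encode n u + encode n v
  | 0, _, _ => rfl
  | n + 1, u, v => by
    rw [encode_succ, pairing_add, Prod.fst_add, Prod.snd_add, encode_add n, encode_add n,
      encode_succ, encode_succ, ← halves_symm_add]
    rfl

theorem encode_zero (n : ℕ) : encode n 0 = 0 := by
  have h := encode_add n 0 0
  rw [add_zero] at h
  exact left_eq_add.1 h

theorem encode_injective : ∀ n : ℕ, Function.Injective (encode n)
  | 0 => fun _ _ h => h
  | n + 1 => fun u v h => by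
    rw [encode_succ, encode_succ] at h
    have h' := Prod.ext_iff.1 (halves.symm.injective h)
    exact pairing.injective (Prod.ext (encode_injective n h'.1) (encode_injective n h'.2))

/-! ### Rows of the generator matrix and masked strings -/

/-- The string with a single `1` at position `i`. -/
def unitBit {N : ℕ} (i : Fin N) : Bits N := Pi.single i 1

theorem unitBit_ne_zero {N : ℕ} (i : Fin N) : unitBit i ≠ 0 := fun h => by
  have := congrFun h i
  simp [unitBit] at this

/-- The row of `G_N` at position `i`. -/
def generatorRow (n : ℕ) (i : Fin (2 ^ n)) : Bits (2 ^ n) := encode n (unitBit i)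

theorem generatorRow_ne_zero (n : ℕ) (i : Fin (2 ^ n)) : generatorRow n i ≠ 0 := fun h =>
  unitBit_ne_zero i (encode_injective n (h.trans (encode_zero n).symm))

theorem pairing_unitBit {n : ℕ} (i : Fin (2 ^ n)) :
    pairing (unitBit (⟨2 * i + 1, double_succ_lt i.2⟩ : Fin (2 ^ (n + 1)))) =
      (unitBit i, unitBit i) := by
  have h1 : ∀ j : Fin (2 ^ n), (2 * (j : ℕ) = 2 * i + 1) = False := by intro j; simp; omega
  have h2 : ∀ j : Fin (2 ^ n), (2 * (j : ℕ) + 1 = 2 * i + 1) = (j = i) := by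
    intro j; simp [Fin.ext_iff]
  ext j
  · simp [pairing, unitBit, Pi.single_apply, Fin.ext_iff, h1]
  · simp [pairing, unitBit, Pi.single_apply, Fin.ext_iff]

/-- The second bit of a pair is the control of its CNOT gate, so it enters both halves at the same
position. -/
theorem generatorRow_succ (n : ℕ) (i : Fin (2 ^ n)) :
    generatorRow (n + 1) ⟨2 * i + 1, double_succ_lt i.2⟩ =
      halves.symm (generatorRow n i, generatorRow n i) := by
  rw [generatorRow, encode_succ, pairing_unitBit, generatorRow]

/-- Setting the first `m` bits to zero. -/
def mask {N : ℕ} (m : ℕ) (u : Bits N) : Bits N := fun j => if (j : ℕ) < m then 0 else u j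

theorem mask_succ_add {N : ℕ} (i : Fin N) (u : Bits N) (h : u i = 1) :
    mask i u = mask (i + 1) u + unitBit i := by
  funext j
  rcases lt_trichotomy (j : ℕ) i with hj | hj | hj
  · have : j ≠ i := fun h => by simp [h] at hj
    simp [mask, unitBit, hj, hj.trans (Nat.lt_succ_self _), this]
  · have : j = i := Fin.ext hj
    subst this
    simp [mask, unitBit, h]
  · have : j ≠ i := fun h => by simp [h] at hj
    have h1 : ¬ (j : ℕ) < i := by omega
    have h2 : ¬ (j : ℕ) < i + 1 := by omega
    simp [mask, unitBit, h1, h2, this]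

theorem mask_succ_eq {N : ℕ} (i : Fin N) (u : Bits N) (h : u i = 0) :
    mask i u = mask (i + 1) u := by
  funext j
  rcases lt_trichotomy (j : ℕ) i with hj | hj | hj
  · simp [mask, hj, hj.trans (Nat.lt_succ_self _)]
  · have : j = i := Fin.ext hj
    subst this
    simp [mask, h]
  · have h1 : ¬ (j : ℕ) < i := by omega
    have h2 : ¬ (j : ℕ) < i + 1 := by omega
    simp [mask, h1, h2]

theorem mask_succ_unitBit {N : ℕ} (i : Fin N) (u : Bits N) :
    mask (i + 1) (u + unitBit i) = mask (i + 1) u := by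
  funext j
  by_cases h : (j : ℕ) < i + 1
  · simp [mask, h]
  · have : j ≠ i := fun h' => by simp [h'] at h
    simp [mask, h, unitBit, this]

theorem pairing_mask {n : ℕ} (m : ℕ) (u : Bits (2 ^ (n + 1))) :
    pairing (mask (2 * m) u) = (mask m (pairing u).1, mask m (pairing u).2) := by
  have h1 : ∀ j : ℕ, (2 * j < 2 * m) = (j < m) := by intro j; simp
  have h2 : ∀ j : ℕ, (2 * j + 1 < 2 * m) = (j < m) := by intro j; simp only [eq_iff_iff]; omega
  ext j
  · by_cases h : (j : ℕ) < m <;> simp [pairing, mask, h1, h2, h]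
  · simp [pairing, mask, h2]

/-! ### Tail distributions and their recursion -/

/-- The product distribution of the flips of `N` bits. -/
def flipProb (w : Fin 2 → ℝ) {N : ℕ} (c : Bits N) : ℝ := ∏ j, w (c j)

/-- The distribution of `k + (0, …, 0, u_{m+1}, …, u_N) G_N` where the bits of `k` are independent
with distribution `w` and the `uⱼ` are uniform. -/
def tailDist (w : Fin 2 → ℝ) (n m : ℕ) (c : Bits (2 ^ n)) : ℝ :=
  (∑ u, flipProb w (c + encode n (mask m u))) / 2 ^ 2 ^ n

section TailDist

variable {w : Fin 2 → ℝ} {n : ℕ}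

theorem tailDist_nonneg (hw : ∀ x, 0 ≤ w x) (m : ℕ) (c : Bits (2 ^ n)) : 0 ≤ tailDist w n m c :=
  div_nonneg (Finset.sum_nonneg fun _ _ => Finset.prod_nonneg fun _ _ => hw _) (by positivity)

theorem sum_flipProb (hw : ∑ x, w x = 1) (N : ℕ) : ∑ c : Bits N, flipProb w c = 1 := by
  have h := Finset.prod_univ_sum (fun _ : Fin N => (Finset.univ : Finset (Fin 2))) (fun _ x => w x)
  rw [Fintype.piFinset_univ] at h
  simp only [flipProb, ← h, hw, Finset.prod_const_one]

theorem sum_tailDist (hw : ∑ x, w x = 1) (m : ℕ) : ∑ c, tailDist w n m c = 1 := by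
  simp only [tailDist]
  rw [← Finset.sum_div, Finset.sum_comm]
  have h : ∀ u : Bits (2 ^ n), ∑ c, flipProb w (c + encode n (mask m u)) = 1 := fun u => by
    rw [← sum_flipProb hw (2 ^ n)]
    exact Equiv.sum_comp (Equiv.addRight (encode n (mask m u))) (flipProb w)
  simp [h]

theorem tailDist_succ (i : Fin (2 ^ n)) (c : Bits (2 ^ n)) :
    tailDist w n i c =
      (tailDist w n (i + 1) c + tailDist w n (i + 1) (c + generatorRow n i)) / 2 := by
  simp only [tailDist]
  rw [← add_div, div_div, mul_comm, ← div_div]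
  congr 1
  rw [eq_div_iff two_ne_zero, mul_two]
  -- One of two copies of the sum is reindexed by flipping bit i. For every u exactly one of the two
  -- summands then has bit i set, and that one is translated by the row of G_N.
  nth_rewrite 2 [← Equiv.sum_comp (Equiv.addRight (unitBit i))]
  rw [← Finset.sum_add_distrib, ← Finset.sum_add_distrib]
  refine Finset.sum_congr rfl fun u _ => ?_
  simp only [Equiv.coe_addRight]
  have h01 : ∀ x : Fin 2, x = 0 ∨ x = 1 := by decide
  have hi : (u + unitBit i) i = u i + 1 := by simp [unitBit]
  rcases h01 (u i) with h | h
  · rw [mask_succ_eq i u h, mask_succ_add i (u + unitBit i) (by rw [hi, h]; rfl),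
      mask_succ_unitBit, encode_add, generatorRow, add_assoc c, add_comm (encode n (unitBit i))]
  · rw [mask_succ_add i u h, mask_succ_eq i (u + unitBit i) (by rw [hi, h]; rfl),
      mask_succ_unitBit, encode_add, generatorRow, add_assoc c, add_comm (encode n (unitBit i)),
      add_comm (flipProb w (c + encode n (mask (i + 1) u)))]

/-- Masking an even number of bits respects the pairs, so under `pairing` the tail becomes two
independent tails of half the length. This independence is the source of the conservation of
information in `coordinateInfo_split`. -/
theorem tailDist_double (m : ℕ) (c : Bits (2 ^ (n + 1))) :
    tailDist w (n + 1) (2 * m) c =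
      tailDist w n m (halves c).1 * tailDist w n m (halves c).2 := by
  simp only [tailDist]
  rw [div_mul_div_comm, ← pow_add, show 2 ^ n + 2 ^ n = 2 ^ (n + 1) by rw [pow_succ]; omega,
    Finset.sum_mul_sum, ← Finset.sum_product', Finset.univ_product_univ, ← Equiv.sum_comp pairing]
  congr 1
  refine Finset.sum_congr rfl fun u _ => ?_
  rw [encode_succ, pairing_mask, flipProb, prod_halves, halves_add, Equiv.apply_symm_apply]
  rfl

/-- The row at position 2i + 1 is (g, g), so the bit there translates both halves simultaneously.
This is the correlated average to which `entropyGain_gap` applies. -/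
theorem tailDist_double_succ (i : Fin (2 ^ n)) (c : Bits (2 ^ (n + 1))) :
    tailDist w (n + 1) (2 * i + 1) c =
      (tailDist w n (i + 1) (halves c).1 * tailDist w n (i + 1) (halves c).2 +
        tailDist w n (i + 1) ((halves c).1 + generatorRow n i) *
          tailDist w n (i + 1) ((halves c).2 + generatorRow n i)) / 2 := by
  have h := tailDist_succ (w := w) (⟨2 * i + 1, double_succ_lt i.2⟩ : Fin (2 ^ (n + 1))) c
  simp only [show 2 * (i : ℕ) + 1 + 1 = 2 * (i + 1) by ring] at h
  rw [h, tailDist_double, tailDist_double, generatorRow_succ, halves_add, Equiv.apply_symm_apply]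
  rfl

theorem mask_of_le {N m : ℕ} (h : N ≤ m) (u : Bits N) : mask m u = 0 := by
  funext j
  simp [mask, j.2.trans_le h]

theorem tailDist_of_le {m : ℕ} (h : 2 ^ n ≤ m) (c : Bits (2 ^ n)) :
    tailDist w n m c = flipProb w c := by
  simp [tailDist, mask_of_le h, encode_zero]

end TailDist

/-! ### Entropies of symmetrized distributions -/

section Symmetrize

variable {C D : Type*} [Fintype C] [Fintype D]

theorem shannonEntropy_eq_div (p : C → ℝ) :
    shannonEntropy p = (∑ c, negMulLog (p c)) / log 2 := by
  rw [shannonEntropy, Finset.sum_div]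

theorem shannonEntropy_comp_equiv (σ : D ≃ C) (p : C → ℝ) :
    shannonEntropy (fun d => p (σ d)) = shannonEntropy p :=
  Equiv.sum_comp σ fun c => negMulLog (p c) / log 2

theorem shannonEntropy_prod {p : C → ℝ} {q : D → ℝ} (hp : ∑ c, p c = 1) (hq : ∑ d, q d = 1) :
    shannonEntropy (fun z : C × D => p z.1 * q z.2) = shannonEntropy p + shannonEntropy q := by
  simp only [shannonEntropy_eq_div, negMulLog_mul, Fintype.sum_prod_type, Finset.sum_add_distrib,
    ← Finset.mul_sum, ← Finset.sum_mul, hp, hq, one_mul, add_div]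

/-- The average of a distribution and its image under a permutation. -/
def symmetrize (τ : Equiv.Perm C) (q : C → ℝ) (c : C) : ℝ := (q c + q (τ c)) / 2

theorem sum_symmetrize (τ : Equiv.Perm C) {q : C → ℝ} (hq : ∑ c, q c = 1) :
    ∑ c, symmetrize τ q c = 1 := by
  simp only [symmetrize]
  rw [← Finset.sum_div, Finset.sum_add_distrib, Equiv.sum_comp τ q, hq]
  norm_num

theorem sum_eq_sum_half_add (τ : Equiv.Perm C) (f : C → ℝ) :
    ∑ c, f c = ∑ c, (f c + f (τ c)) / 2 := by
  rw [← Finset.sum_div, Finset.sum_add_distrib, Equiv.sum_comp τ f]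
  ring

/-- Concavity of the entropy, together with its invariance under permutations. -/
theorem shannonEntropy_le_symmetrize (τ : Equiv.Perm C) {q : C → ℝ} (hq : ∀ c, 0 ≤ q c) :
    shannonEntropy q ≤ shannonEntropy (symmetrize τ q) := by
  rw [shannonEntropy_eq_div, shannonEntropy_eq_div, sum_eq_sum_half_add τ]
  refine div_le_div_of_nonneg_right (Finset.sum_le_sum fun c _ => ?_) (log_nonneg (by norm_num))
  have := negMulLog_add_le (hq c) (hq (τ c))
  rw [symmetrize]
  linarith

/-- The deficiency of the entropy gain under symmetrization. -/
theorem log_two_sub_entropyGain (τ : Equiv.Perm C) {q : C → ℝ} (h1 : ∑ c, q c = 1) :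
    log 2 - (∑ c, negMulLog (symmetrize τ q c) - ∑ c, negMulLog (q c)) =
      ∑ c, (negMulLog (q c) + negMulLog (q (τ c)) - negMulLog (q c + q (τ c))) / 2 := by
  have h : ∀ c, negMulLog (symmetrize τ q c) =
      negMulLog (q c + q (τ c)) / 2 + symmetrize τ q c * log 2 := fun c => by
    have := two_mul_negMulLog_half (q c + q (τ c))
    rw [symmetrize]
    linarith
  rw [Finset.sum_congr rfl fun c _ => h c, sum_eq_sum_half_add τ fun c => negMulLog (q c),
    Finset.sum_add_distrib, ← Finset.sum_mul, sum_symmetrize τ h1]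
  simp only [sub_div, Finset.sum_sub_distrib]
  ring

theorem symmetrize_sub_le_one (τ : Equiv.Perm C) {q : C → ℝ} (hq : ∀ c, 0 ≤ q c)
    (h1 : ∑ c, q c = 1) : shannonEntropy (symmetrize τ q) - shannonEntropy q ≤ 1 := by
  have hlog : 0 < log 2 := log_pos (by norm_num)
  rw [shannonEntropy_eq_div, shannonEntropy_eq_div, ← sub_div, div_le_one hlog, ← sub_nonneg,
    log_two_sub_entropyGain τ h1]
  refine Finset.sum_nonneg fun c _ => ?_
  have := negMulLog_add_le_add (hq c) (hq (τ c))
  linarith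

/-- The bias |y|x is the convex combination of the biases 0 and x with weights 1 - |y| and |y|;
concavity of the binary entropy does the rest. -/
theorem log_two_sub_biasEntropy_mul_le {x y : ℝ} (hx : |x| ≤ 1) (hy : |y| ≤ 1) :
    log 2 - biasEntropy (x * y) ≤ |y| * (log 2 - biasEntropy x) := by
  have h : biasEntropy (x * y) = biasEntropy (|y| * x) := by
    rcases abs_choice y with h | h <;> rw [h]
    · rw [mul_comm]
    · rw [neg_mul, biasEntropy_neg, mul_comm]
  rw [abs_le] at hx
  have hconc := strictConcave_binEntropy.concaveOn.2 (x := (1 + 0) / 2) (y := (1 + x) / 2)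
    ⟨by norm_num, by norm_num⟩ ⟨by linarith, by linarith⟩
    (sub_nonneg.2 hy) (abs_nonneg y) (by ring)
  simp only [smul_eq_mul] at hconc
  rw [show (1 - |y|) * ((1 + 0) / 2) + |y| * ((1 + x) / 2) = (1 + |y| * x) / 2 by ring] at hconc
  change (1 - |y|) * biasEntropy 0 + |y| * biasEntropy x ≤ biasEntropy (|y| * x) at hconc
  rw [biasEntropy_zero] at hconc
  rw [h]
  linarith

/-- The homogeneous form of `log_two_sub_biasEntropy_mul_le`: weights m ± d and m' ± d' combine to
mm' ± dd', and the biases d/m and d'/m' multiply. -/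
theorem pairEntropy_mul_ge {m d m' d' : ℝ} (hd : |d| ≤ m) (hd' : |d'| ≤ m') :
    m' * negMulLog m + m * negMulLog m' - |d'| * (negMulLog m - pairEntropy (2 * m) (2 * d) / 2) ≤
      pairEntropy (2 * (m * m')) (2 * (d * d')) / 2 := by
  have hm := (abs_nonneg d).trans hd
  have hm' := (abs_nonneg d').trans hd'
  rcases hm.eq_or_lt with h | hm0
  · have : d = 0 := abs_nonpos_iff.1 (by rwa [h])
    simp [← h, this, pairEntropy]
  rcases hm'.eq_or_lt with h | hm0'
  · have : d' = 0 := abs_nonpos_iff.1 (by rwa [h])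
    simp [← h, this, pairEntropy]
  have hN : ∀ u x : ℝ, pairEntropy (2 * u) (2 * (u * x)) / 2 =
      negMulLog u - u * (log 2 - biasEntropy x) := by
    intro u x
    have := two_mul_negMulLog_half (2 * u)
    rw [mul_div_cancel_left₀ _ (two_ne_zero' ℝ)] at this
    rw [← mul_assoc, pairEntropy_mul]
    linarith
  obtain ⟨x, rfl⟩ : ∃ x, d = m * x := ⟨d / m, by field_simp⟩
  obtain ⟨y, rfl⟩ : ∃ y, d' = m' * y := ⟨d' / m', by field_simp⟩
  rw [abs_mul, abs_of_pos hm0, mul_le_iff_le_one_right hm0] at hd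
  rw [abs_mul, abs_of_pos hm0', mul_le_iff_le_one_right hm0'] at hd'
  rw [show m * x * (m' * y) = m * m' * (x * y) by ring, hN, hN, negMulLog_mul, abs_mul,
    abs_of_pos hm0']
  have := mul_le_mul_of_nonneg_left (log_two_sub_biasEntropy_mul_le hd hd') (mul_pos hm0 hm0').le
  linarith

/-- A quantitative lower bound for the loss of information in the first step of the polar
transform. -/
theorem entropyGain_gap {τ : Equiv.Perm C} (hτ : ∀ c, τ (τ c) = c) {q : C → ℝ}
    (hq : ∀ c, 0 ≤ q c) (h1 : ∑ c, q c = 1) {J : ℝ}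
    (hJ : J = shannonEntropy (symmetrize τ q) - shannonEntropy q) :
    log 2 ^ 2 / 2 * (J * (1 - J) ^ 2) ≤
      shannonEntropy (fun p : C × C => (q p.1 * q p.2 + q (τ p.1) * q (τ p.2)) / 2) -
        shannonEntropy (symmetrize τ q) - shannonEntropy q := by
  have hlog : 0 < log 2 := log_pos (by norm_num)
  have hJ0 : 0 ≤ J := by rw [hJ, sub_nonneg]; exact shannonEntropy_le_symmetrize τ hq
  set m := symmetrize τ q with hm
  -- With q = m + d and q ∘ τ = m - d, the averaged product at (c, c') is m(c)m(c') + d(c)d(c').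
  set d : C → ℝ := fun c => (q c - q (τ c)) / 2 with hd
  have hdm : ∀ c, |d c| ≤ m c := fun c => by
    rw [abs_le]
    simp only [hm, hd, symmetrize]
    constructor <;> linarith [hq c, hq (τ c)]
  have hm1 : ∑ c, m c = 1 := sum_symmetrize τ h1
  have hqm : ∀ c, q c = m c + d c := fun c => by simp only [hm, hd, symmetrize]; ring
  have hqm' : ∀ c, q (τ c) = m c - d c := fun c => by simp only [hm, hd, symmetrize]; ring
  set Δ := ∑ c, |d c|
  have hΔ0 : 0 ≤ Δ := Finset.sum_nonneg fun c _ => abs_nonneg _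
  have hΔ1 : Δ ≤ 1 := by rw [← hm1]; exact Finset.sum_le_sum fun c _ => hdm c
  have hHq : ∑ c, pairEntropy (2 * m c) (2 * d c) / 2 = ∑ c, negMulLog (q c) := by
    rw [sum_eq_sum_half_add τ fun c => negMulLog (q c)]
    refine Finset.sum_congr rfl fun c _ => ?_
    rw [pairEntropy, hqm, hqm']
    congr 3 <;> ring
  have hprod : ∑ p : C × C, negMulLog ((q p.1 * q p.2 + q (τ p.1) * q (τ p.2)) / 2) =
      ∑ c, ∑ c', pairEntropy (2 * (m c * m c')) (2 * (d c * d c')) / 2 := by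
    -- Averaging over τ in the first variable alone pairs mm' + dd' with mm' - dd'.
    rw [Fintype.sum_prod_type, sum_eq_sum_half_add τ]
    refine Finset.sum_congr rfl fun c _ => ?_
    rw [← Finset.sum_add_distrib, Finset.sum_div]
    refine Finset.sum_congr rfl fun c' _ => ?_
    simp only [hτ]
    rw [pairEntropy, hqm c, hqm' c, hqm c', hqm' c']
    congr 3 <;> ring
  -- Summing `pairEntropy_mul_ge` over all pairs bounds the gap below by J(1 - Δ), where Δ is the
  -- total variation distance of q and q ∘ τ.
  have hlow : 2 * ∑ c, negMulLog (m c) -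
      Δ * (∑ c, negMulLog (m c) - ∑ c, negMulLog (q c)) ≤
      ∑ p : C × C, negMulLog ((q p.1 * q p.2 + q (τ p.1) * q (τ p.2)) / 2) := by
    rw [hprod]
    calc _ = ∑ c, ∑ c', (m c' * negMulLog (m c) + m c * negMulLog (m c') -
          |d c'| * (negMulLog (m c) - pairEntropy (2 * m c) (2 * d c) / 2)) := by
          simp only [Finset.sum_add_distrib, Finset.sum_sub_distrib, ← Finset.sum_mul,
            ← Finset.mul_sum, hm1, hHq]
          ring
      _ ≤ _ := Finset.sum_le_sum fun c _ => Finset.sum_le_sum fun c' _ =>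
          pairEntropy_mul_ge (hdm c) (hdm c')
  have hJlog : J * log 2 = ∑ c, negMulLog (m c) - ∑ c, negMulLog (q c) := by
    rw [hJ, shannonEntropy_eq_div, shannonEntropy_eq_div]
    field_simp
  -- It remains to keep Δ away from 1 when J is. The deficiency of J is at most the Bhattacharyya
  -- coefficient of q and q ∘ τ, which Cauchy–Schwarz bounds by √(1 - Δ²).
  have hbhat : log 2 * (1 - J) ≤ √(1 - Δ) * √(1 + Δ) := by
    have h := log_two_sub_entropyGain τ h1
    rw [← hJlog] at h
    calc log 2 * (1 - J) = log 2 - J * log 2 := by ring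
      _ = _ := h
      _ ≤ ∑ c, √(m c - |d c|) * √(m c + |d c|) := by
          refine Finset.sum_le_sum fun c _ => ?_
          have h2 := negMulLog_add_sub_le (hq c) (hq (τ c))
          have h3 : q c * q (τ c) = (m c - |d c|) * (m c + |d c|) := by
            rw [hqm c, hqm' c]
            nlinarith [sq_abs (d c)]
          rw [h3, sqrt_mul (sub_nonneg.2 (hdm c))] at h2
          linarith
      _ ≤ √(∑ c, (m c - |d c|)) * √(∑ c, (m c + |d c|)) :=
          sum_sqrt_mul_sqrt_le _ (fun c => sub_nonneg.2 (hdm c))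
            (fun c => add_nonneg ((abs_nonneg _).trans (hdm c)) (abs_nonneg _))
      _ = _ := by rw [Finset.sum_sub_distrib, Finset.sum_add_distrib, hm1]
  have hJ1 : J ≤ 1 := hJ ▸ symmetrize_sub_le_one τ hq h1
  have hsq : log 2 ^ 2 * (1 - J) ^ 2 ≤ 2 * (1 - Δ) := by
    have h := pow_le_pow_left₀ (mul_nonneg hlog.le (sub_nonneg.2 hJ1)) hbhat 2
    rw [mul_pow, mul_pow, sq_sqrt (by linarith), sq_sqrt (by linarith)] at h
    nlinarith
  have hgap : J * (1 - Δ) ≤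
      shannonEntropy (fun p : C × C => (q p.1 * q p.2 + q (τ p.1) * q (τ p.2)) / 2) -
        shannonEntropy m - shannonEntropy q := by
    rw [shannonEntropy_eq_div, shannonEntropy_eq_div, shannonEntropy_eq_div, ← sub_div, ← sub_div,
      le_div_iff₀ hlog]
    have : J * (1 - Δ) * log 2 = J * log 2 - Δ * (J * log 2) := by ring
    rw [this, hJlog]
    linarith
  nlinarith [mul_le_mul_of_nonneg_left hsq hJ0]

end Symmetrize

/-! ### Polarization of a recursively split family of numbers -/

theorem sum_range_two_mul (f : ℕ → ℝ) (k : ℕ) :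
    ∑ i ∈ Finset.range (2 * k), f i = ∑ i ∈ Finset.range k, (f (2 * i) + f (2 * i + 1)) := by
  induction k with
  | zero => simp
  | succ k ih =>
    rw [Finset.sum_range_succ, ← ih, show 2 * (k + 1) = 2 * k + 1 + 1 by ring,
      Finset.sum_range_succ, Finset.sum_range_succ]
    ring

/-- If numbers in `[0, 1]` are repeatedly split into two numbers with the same mean, which move
away from each other by an amount controlled from below inside `(0, 1)`, then they polarize. -/
theorem tendsto_average_of_split {X : ℕ → ℕ → ℝ} (h0 : ∀ n i, i < 2 ^ n → 0 ≤ X n i)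
    (h1 : ∀ n i, i < 2 ^ n → X n i ≤ 1)
    (hmean : ∀ n i, i < 2 ^ n → X (n + 1) (2 * i) + X (n + 1) (2 * i + 1) = 2 * X n i)
    {κ : ℝ} (hκ : 0 < κ)
    (hgap : ∀ n i, i < 2 ^ n → κ * (X n i * (1 - X n i) ^ 2) ≤ X n i - X (n + 1) (2 * i))
    {χ : ℝ → ℝ} {γ : ℝ} (hγ : 0 < γ) (hχ : ∀ x, 0 ≤ χ x ∧ χ x ≤ 1)
    (hχ0 : ∀ x, 0 ≤ x → x < γ → χ x = 0) (hχ1 : ∀ x, x ≤ 1 → 1 - γ < x → χ x = 1) :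
    Tendsto (fun n => (∑ i ∈ Finset.range (2 ^ n), χ (X n i)) / 2 ^ n) atTop (𝓝 (X 0 0)) := by
  set φ : ℝ → ℝ := fun x => (x * (1 - x) ^ 2) ^ 2 with hφ
  have hpow : ∀ n : ℕ, (0 : ℝ) < 2 ^ n := fun n => by positivity
  have hm : ∀ n, (∑ i ∈ Finset.range (2 ^ n), X n i) / 2 ^ n = X 0 0 := by
    intro n
    induction n with
    | zero => simp
    | succ n ih =>
      rw [← ih, pow_succ' 2 n, sum_range_two_mul,
        Finset.sum_congr rfl fun i hi => hmean n i (Finset.mem_range.1 hi), ← Finset.mul_sum,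
        pow_succ' (2 : ℝ) n, mul_div_mul_left _ _ two_ne_zero]
  -- Splitting x into x - g and x + g raises the mean square by g², and g² ≥ κ² φ(x). Since Q is
  -- bounded, its increments, and with them the averages of φ, tend to 0.
  set Q : ℕ → ℝ := fun n => (∑ i ∈ Finset.range (2 ^ n), X n i ^ 2) / 2 ^ n with hQ
  have hstep : ∀ n, κ ^ 2 * ((∑ i ∈ Finset.range (2 ^ n), φ (X n i)) / 2 ^ n) ≤ Q (n + 1) - Q n := by
    intro n
    have : Q (n + 1) = (∑ i ∈ Finset.range (2 ^ n),
        (X (n + 1) (2 * i) ^ 2 + X (n + 1) (2 * i + 1) ^ 2) / 2) / 2 ^ n := by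
      simp only [hQ]
      rw [pow_succ' 2 n, sum_range_two_mul, pow_succ' (2 : ℝ) n, ← Finset.sum_div, div_div]
    rw [this, hQ, ← sub_div, ← mul_div_assoc, Finset.mul_sum, ← Finset.sum_sub_distrib]
    refine div_le_div_of_nonneg_right (Finset.sum_le_sum fun i hi => ?_) (hpow n).le
    have hi := Finset.mem_range.1 hi
    have hg := hgap n i hi
    have hg0 : 0 ≤ κ * (X n i * (1 - X n i) ^ 2) := by
      have := h0 n i hi
      positivity
    have h2 := pow_le_pow_left₀ hg0 hg 2
    have h3 : X (n + 1) (2 * i + 1) = 2 * X n i - X (n + 1) (2 * i) := by linarith [hmean n i hi]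
    rw [h3]
    simp only [hφ]
    nlinarith
  have hφ0 : ∀ x, 0 ≤ φ x := fun x => sq_nonneg _
  have hφs : ∀ n, 0 ≤ (∑ i ∈ Finset.range (2 ^ n), φ (X n i)) / 2 ^ n := fun n =>
    div_nonneg (Finset.sum_nonneg fun i _ => hφ0 _) (hpow n).le
  have hQmono : Monotone Q := monotone_nat_of_le_succ fun n => by
    have := mul_nonneg (sq_nonneg κ) (hφs n)
    linarith [hstep n]
  have hQle : ∀ n, Q n ≤ 1 := fun n => by
    simp only [hQ]
    rw [div_le_one (hpow n)]
    calc _ ≤ ∑ i ∈ Finset.range (2 ^ n), (1 : ℝ) := Finset.sum_le_sum fun i hi =>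
          pow_le_one₀ (h0 n i (Finset.mem_range.1 hi)) (h1 n i (Finset.mem_range.1 hi))
      _ = _ := by simp
  have hφlim : Tendsto (fun n => (∑ i ∈ Finset.range (2 ^ n), φ (X n i)) / 2 ^ n) atTop (𝓝 0) := by
    have hlim := tendsto_atTop_ciSup hQmono ⟨1, by rintro _ ⟨n, rfl⟩; exact hQle n⟩
    have hdiff : Tendsto (fun n => (Q (n + 1) - Q n) / κ ^ 2) atTop (𝓝 0) := by
      have := ((hlim.comp (tendsto_add_atTop_nat 1)).sub hlim).div_const (κ ^ 2)
      simpa using this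
    refine squeeze_zero hφs (fun n => ?_) hdiff
    rw [le_div_iff₀ (by positivity), mul_comm]
    exact hstep n
  rw [Metric.tendsto_atTop]
  intro ε hε
  set η := min (min (ε / 2) γ) (1 / 2) with hη
  have hη0 : 0 < η := by positivity
  have hηε : η ≤ ε / 2 := (min_le_left _ _).trans (min_le_left _ _)
  have hηγ : η ≤ γ := (min_le_left _ _).trans (min_le_right _ _)
  -- Within η of an endpoint χ agrees with the endpoint, up to an error η ≤ ε/2 against x. In
  -- between x and 1 - x are at least η, so φ(x) ≥ η⁶ pays for the trivial bound 1.
  have hpt : ∀ x, 0 ≤ x → x ≤ 1 → |χ x - x| ≤ ε / 2 + φ x / η ^ 6 := by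
    intro x hx0 hx1
    have hnn : 0 ≤ φ x / η ^ 6 := div_nonneg (hφ0 x) (by positivity)
    rcases lt_or_ge x η with h | h
    · rw [hχ0 x hx0 (h.trans_le hηγ), zero_sub, abs_neg, abs_of_nonneg hx0]
      linarith
    rcases lt_or_ge (1 - η) x with h' | h'
    · rw [hχ1 x hx1 (by linarith), abs_of_nonneg (by linarith)]
      linarith
    have hle : η ^ 6 ≤ φ x := by
      have h2 : η * η ^ 2 ≤ x * (1 - x) ^ 2 :=
        mul_le_mul h (pow_le_pow_left₀ hη0.le (by linarith) 2) (by positivity) hx0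
      calc η ^ 6 = (η * η ^ 2) ^ 2 := by ring
        _ ≤ _ := pow_le_pow_left₀ (by positivity) h2 2
    have h3 : 1 ≤ φ x / η ^ 6 := by rwa [one_le_div (by positivity)]
    have h4 : |χ x - x| ≤ 1 := by
      rw [abs_le]; constructor <;> linarith [(hχ x).1, (hχ x).2]
    linarith
  obtain ⟨n₀, hn₀⟩ := Metric.tendsto_atTop.1 hφlim (ε / 2 * η ^ 6) (by positivity)
  refine ⟨n₀, fun n hn => ?_⟩
  have hsmall := hn₀ n hn
  rw [Real.dist_eq, sub_zero, abs_of_nonneg (hφs n)] at hsmall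
  rw [Real.dist_eq, ← hm n, ← sub_div, ← Finset.sum_sub_distrib, abs_div, abs_of_pos (hpow n)]
  calc _ ≤ (∑ i ∈ Finset.range (2 ^ n), (ε / 2 + φ (X n i) / η ^ 6)) / 2 ^ n := by
        refine div_le_div_of_nonneg_right ((Finset.abs_sum_le_sum_abs _ _).trans
          (Finset.sum_le_sum fun i hi => ?_)) (hpow n).le
        have hi := Finset.mem_range.1 hi
        exact hpt _ (h0 n i hi) (h1 n i hi)
    _ = ε / 2 + (∑ i ∈ Finset.range (2 ^ n), φ (X n i)) / 2 ^ n / η ^ 6 := by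
        rw [Finset.sum_add_distrib, Finset.sum_const, Finset.card_range, nsmul_eq_mul,
          ← Finset.sum_div, add_div]
        push_cast
        rw [mul_div_cancel_left₀ _ (hpow n).ne', div_right_comm]
    _ < ε / 2 + ε / 2 := by
        rw [add_lt_add_iff_left, div_lt_iff₀ (by positivity)]
        exact hsmall
    _ = ε := by ring

/-! ### Information of the coordinate channels -/

/-- The information of the coordinate channel at position `i`, as a difference of entropies of the
tail distributions. -/
def coordinateInfo (w : Fin 2 → ℝ) (n i : ℕ) : ℝ :=
  shannonEntropy (tailDist w n i) - shannonEntropy (tailDist w n (i + 1))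

/-- Translation by the row of `G_N` at position `i`. -/
def rowShift (n : ℕ) (i : Fin (2 ^ n)) : Equiv.Perm (Bits (2 ^ n)) :=
  Equiv.addRight (generatorRow n i)

theorem rowShift_rowShift (n : ℕ) (i : Fin (2 ^ n)) (c : Bits (2 ^ n)) :
    rowShift n i (rowShift n i c) = c :=
  bits_add_add_cancel c _

section Info

variable {w : Fin 2 → ℝ} (hw : ∀ x, 0 ≤ w x) (hw1 : ∑ x, w x = 1)

theorem tailDist_eq_symmetrize (w : Fin 2 → ℝ) (n : ℕ) (i : Fin (2 ^ n)) :
    tailDist w n i = symmetrize (rowShift n i) (tailDist w n (i + 1)) := by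
  funext c
  exact tailDist_succ i c

include hw in
theorem coordinateInfo_nonneg {n i : ℕ} (hi : i < 2 ^ n) : 0 ≤ coordinateInfo w n i := by
  rw [coordinateInfo, sub_nonneg, tailDist_eq_symmetrize w n ⟨i, hi⟩]
  exact shannonEntropy_le_symmetrize _ (tailDist_nonneg hw _)

include hw hw1 in
theorem coordinateInfo_le_one {n i : ℕ} (hi : i < 2 ^ n) : coordinateInfo w n i ≤ 1 := by
  rw [coordinateInfo, tailDist_eq_symmetrize w n ⟨i, hi⟩]
  exact symmetrize_sub_le_one _ (tailDist_nonneg hw _) (sum_tailDist hw1 _)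

include hw1 in
theorem shannonEntropy_tailDist_double (n m : ℕ) :
    shannonEntropy (tailDist w (n + 1) (2 * m)) = 2 * shannonEntropy (tailDist w n m) := by
  rw [two_mul (shannonEntropy _), ← shannonEntropy_prod (sum_tailDist hw1 m) (sum_tailDist hw1 m),
    ← shannonEntropy_comp_equiv halves]
  congr 1
  funext c
  exact tailDist_double m c

include hw1 in
theorem coordinateInfo_split (n i : ℕ) :
    coordinateInfo w (n + 1) (2 * i) + coordinateInfo w (n + 1) (2 * i + 1) =
      2 * coordinateInfo w n i := by
  simp only [coordinateInfo]
  rw [show 2 * i + 1 + 1 = 2 * (i + 1) by ring, shannonEntropy_tailDist_double hw1,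
    shannonEntropy_tailDist_double hw1]
  ring

include hw hw1 in
-- The even child 2i is the worse one. By `shannonEntropy_tailDist_double`, its loss is the entropy
-- at 2i + 1 minus the entropies at i and i + 1 one level below, which is the left-over term in
-- `entropyGain_gap`.
theorem coordinateInfo_gap {n i : ℕ} (hi : i < 2 ^ n) :
    log 2 ^ 2 / 2 * (coordinateInfo w n i * (1 - coordinateInfo w n i) ^ 2) ≤
      coordinateInfo w n i - coordinateInfo w (n + 1) (2 * i) := by
  have h := entropyGain_gap (rowShift_rowShift n ⟨i, hi⟩) (tailDist_nonneg hw (i + 1))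
    (sum_tailDist hw1 (i + 1)) (J := coordinateInfo w n i)
    (by rw [coordinateInfo, tailDist_eq_symmetrize w n ⟨i, hi⟩])
  rw [← tailDist_eq_symmetrize w n ⟨i, hi⟩] at h
  have h2 : shannonEntropy (tailDist w (n + 1) (2 * i + 1)) =
      shannonEntropy (fun p : Bits (2 ^ n) × Bits (2 ^ n) =>
        (tailDist w n (i + 1) p.1 * tailDist w n (i + 1) p.2 +
          tailDist w n (i + 1) (rowShift n ⟨i, hi⟩ p.1) *
            tailDist w n (i + 1) (rowShift n ⟨i, hi⟩ p.2)) / 2) := by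
    rw [← shannonEntropy_comp_equiv halves]
    congr 1
    funext c
    exact tailDist_double_succ ⟨i, hi⟩ c
  rw [← h2] at h
  refine h.trans_eq ?_
  simp only [coordinateInfo]
  rw [shannonEntropy_tailDist_double hw1]
  ring

include hw hw1 in
/-- Polarization of the coordinate channels. -/
theorem tendsto_average_coordinateInfo {χ : ℝ → ℝ} {γ : ℝ} (hγ : 0 < γ)
    (hχ : ∀ x, 0 ≤ χ x ∧ χ x ≤ 1) (hχ0 : ∀ x, 0 ≤ x → x < γ → χ x = 0)
    (hχ1 : ∀ x, x ≤ 1 → 1 - γ < x → χ x = 1) :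
    Tendsto (fun n => (∑ i : Fin (2 ^ n), χ (coordinateInfo w n i)) / 2 ^ n) atTop
      (𝓝 (coordinateInfo w 0 0)) := by
  have hlog : 0 < log 2 := log_pos (by norm_num)
  have h := tendsto_average_of_split (X := coordinateInfo w) (κ := log 2 ^ 2 / 2)
    (fun _ _ => coordinateInfo_nonneg hw) (fun _ _ => coordinateInfo_le_one hw hw1)
    (fun n i _ => coordinateInfo_split hw1 n i) (by positivity)
    (fun _ _ => coordinateInfo_gap hw hw1) hγ hχ hχ0 hχ1
  simpa only [Finset.sum_range] using h

end Info

/-! ### Concatenation of bit strings -/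

section Join

variable {N m : ℕ}

theorem card_lt_subtype (h : m ≤ N) : Fintype.card {j : Fin N // (j : ℕ) < m} = m := by
  rw [Fintype.card_subtype]
  rcases h.eq_or_lt with rfl | h
  · simp
  · have hc := Fin.card_Iio (⟨m, h⟩ : Fin N)
    refine Eq.trans ?_ hc
    congr 1
    ext j
    simp [Fin.lt_def]

theorem card_le_subtype (N m : ℕ) : Fintype.card {j : Fin N // m ≤ (j : ℕ)} = N - m := by
  have h := Fintype.card_subtype_compl (fun j : Fin N => (j : ℕ) < m)
  simp only [not_lt, Fintype.card_fin] at h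
  rcases le_total m N with hm | hm
  · rw [h, card_lt_subtype hm]
  · rw [Nat.sub_eq_zero_of_le hm, Fintype.card_eq_zero_iff]
    exact ⟨fun j => absurd j.1.2 (by have := j.2; omega)⟩

/-- Concatenation as a bijection. -/
def joinEquiv (N m : ℕ) : Before N m × After N m ≃ Bits N where
  toFun p := join p.1 p.2
  invFun u := (fun j => u j, fun j => u j)
  left_inv p := by
    ext j
    · simp [join, j.2]
    · simp [join, not_lt.2 j.2]
  right_inv u := by
    funext j
    simp [join]

theorem mask_join (r : Before N m) (t : After N m) : mask m (join r t) = join 0 t := by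
  funext j
  by_cases h : (j : ℕ) < m <;> simp [mask, join, h]

theorem join_eq_add (r : Before N m) (t : After N m) : join r t = join r 0 + join 0 t := by
  funext j
  by_cases h : (j : ℕ) < m <;> simp [join, h]

theorem join₃_eq_add (i : Fin N) (r : Before N i) (x : Fin 2) (t : After N (i + 1)) :
    join₃ i r x t = join r 0 + join 0 t + x • unitBit i := by
  funext j
  rcases lt_trichotomy (j : ℕ) i with hj | hj | hj
  · have h1 : j ≠ i := fun h => by simp [h] at hj
    have h2 : (j : ℕ) < i + 1 := by omega
    simp [join₃, join, unitBit, hj, h1, h2]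
  · have h1 : j = i := Fin.ext hj
    subst h1
    simp [join₃, join, unitBit]
  · have h1 : j ≠ i := fun h => by simp [h] at hj
    have h2 : ¬ (j : ℕ) < i + 1 := by omega
    have h3 : ¬ (j : ℕ) < i := by omega
    have h4 : (i : ℕ) + 1 ≤ j := by omega
    simp [join₃, join, unitBit, h1, h2, h3, h4]

theorem encode_smul {n : ℕ} (x : Fin 2) (u : Bits (2 ^ n)) : encode n (x • u) = x • encode n u := by
  have h01 : ∀ x : Fin 2, x = 0 ∨ x = 1 := by decide
  rcases h01 x with rfl | rfl
  · rw [zero_smul, zero_smul, encode_zero]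
  · rw [one_smul, one_smul]

theorem encode_join₃ {n : ℕ} (i : Fin (2 ^ n)) (r : Before (2 ^ n) i) (x : Fin 2)
    (t : After (2 ^ n) (i + 1)) :
    encode n (join₃ i r x t) =
      encode n (join r 0) + (encode n (join 0 t) + x • generatorRow n i) := by
  rw [join₃_eq_add, encode_add, encode_add, encode_smul, generatorRow, add_assoc]

/-- The sum defining `tailDist` runs over full strings, so each tail occurs once for each of the 2^m
masked prefixes. -/
theorem tailDist_eq_sum_after {n : ℕ} (w : Fin 2 → ℝ) (hm : m ≤ 2 ^ n) (c : Bits (2 ^ n)) :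
    tailDist w n m c =
      2 ^ m * (∑ t : After (2 ^ n) m, flipProb w (c + encode n (join 0 t))) / 2 ^ 2 ^ n := by
  rw [tailDist, ← Equiv.sum_comp (joinEquiv (2 ^ n) m), Fintype.sum_prod_type]
  simp only [joinEquiv, Equiv.coe_fn_mk, mask_join, Finset.sum_const, Finset.card_univ,
    Fintype.card_fun, Fintype.card_fin, card_lt_subtype hm, nsmul_eq_mul]
  push_cast
  rfl

end Join

/-! ### Output states of the combined channel -/

section Product

variable {ι : Type*} [Fintype ι] [DecidableEq ι]

/-- The product vector of basis vectors, with an arbitrary index type for the qubits. -/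
def ketPi (e : QubitBasis) (Q : ι → Fin 2) : (ι → Fin 2) → ℂ := fun x => ∏ j, ket e (Q j) (x j)

theorem sum_prod_bits {M : Type*} [CommSemiring M] (g : ι → Fin 2 → M) :
    ∑ x : ι → Fin 2, ∏ j, g j (x j) = ∏ j, ∑ y, g j y := by
  rw [Finset.prod_univ_sum, Fintype.piFinset_univ]

theorem sum_star_ketPi_mul (e : QubitBasis) (Q Q' : ι → Fin 2) :
    ∑ x, star (ketPi e Q x) * ketPi e Q' x = if Q = Q' then 1 else 0 := by
  simp only [ketPi, star_prod, ← Finset.prod_mul_distrib]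
  rw [sum_prod_bits fun j y => star (ket e (Q j) y) * ket e (Q' j) y]
  simp only [sum_star_ket_mul_ket, Finset.prod_ite_zero, Finset.prod_const_one, Finset.mem_univ,
    true_implies, funext_iff]

theorem sum_mul_star_ketPi (e : QubitBasis) (a b : (ι → Fin 2) → ℂ) :
    ∑ x, (∑ Q, a Q * ketPi e Q x) * star (∑ Q, b Q * ketPi e Q x) = ∑ Q, a Q * star (b Q) := by
  calc _ = ∑ Q, ∑ Q', a Q * star (b Q') * ∑ x, star (ketPi e Q' x) * ketPi e Q x := by
        simp only [star_sum, star_mul', Finset.sum_mul_sum]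
        simp only [Finset.mul_sum]
        rw [Finset.sum_comm]
        refine Finset.sum_congr rfl fun Q _ => ?_
        rw [Finset.sum_comm]
        refine Finset.sum_congr rfl fun Q' _ => Finset.sum_congr rfl fun x _ => ?_
        ring
    _ = _ := by simp only [sum_star_ketPi_mul]; simp

theorem prod_bell (e : QubitBasis) (z s : ι → Fin 2) :
    ∏ j, bell e (z j) (s j) =
      (√(1 / 2) : ℂ) ^ Fintype.card ι * ∑ u : ι → Fin 2, ketPi e u z * ketPi e u s := by
  simp only [bell, ketPi, ← Finset.prod_mul_distrib]
  rw [sum_prod_bits fun j y => ket e y (z j) * ket e y (s j), ← Finset.card_univ,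
    ← Finset.prod_const, ← Finset.prod_mul_distrib]
  simp only [Finset.mul_sum, mul_assoc]

end Product

section Action

variable {e f : QubitBasis} {E : Fin 2 → Matrix (Fin 2) (Fin 2) ℂ} {w : Fin 2 → ℝ}

/-- The operation elements act on the basis vectors as random bit flips with weights `w`. -/
def ActsAsFlips (e f : QubitBasis) (E : Fin 2 → Matrix (Fin 2) (Fin 2) ℂ) (w : Fin 2 → ℝ) : Prop :=
  (∀ x, 0 ≤ w x) ∧ ∀ k i, E k *ᵥ ket e i = (√(w k) : ℂ) • ket f (k + i)

/-- The amplitude of the flips `k`. -/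
def flipAmplitude (w : Fin 2 → ℝ) {N : ℕ} (k : Bits N) : ℂ := ∏ j, (√(w (k j)) : ℂ)

theorem flipAmplitude_mul_star (hw : ∀ x, 0 ≤ w x) {N : ℕ} (k : Bits N) :
    flipAmplitude w k * star (flipAmplitude w k) = flipProb w k := by
  rw [flipAmplitude, star_prod, ← Finset.prod_mul_distrib, flipProb, Complex.ofReal_prod]
  refine Finset.prod_congr rfl fun j _ => ?_
  rw [Complex.star_def, Complex.conj_ofReal, ← Complex.ofReal_mul, mul_self_sqrt (hw _)]

theorem nCopyElement_mulVec_ketN (hE : ActsAsFlips e f E w) {N : ℕ} (k Q : Bits N) :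
    nCopyElement E k *ᵥ ketN e Q = flipAmplitude w k • ketN f (k + Q) := by
  funext x
  simp only [Matrix.mulVec, dotProduct, nCopyElement, Matrix.of_apply, ketN,
    ← Finset.prod_mul_distrib, Pi.smul_apply, smul_eq_mul, flipAmplitude]
  rw [sum_prod_bits fun j y => E (k j) (x j) y * ket e (Q j) y]
  exact Finset.prod_congr rfl fun j _ => congrFun (hE.2 (k j) (Q j)) (x j)

theorem encodingUnitary_mulVec_ketN (e : QubitBasis) (n : ℕ) (Q : Bits (2 ^ n)) :
    encodingUnitary e n *ᵥ ketN e Q = ketN e (encode n Q) := by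
  have h : ∀ Q', star (ketN e Q') ⬝ᵥ ketN e Q = if Q' = Q then 1 else 0 :=
    fun Q' => sum_star_ketPi_mul e Q' Q
  rw [encodingUnitary, Matrix.sum_mulVec]
  simp [Matrix.vecMulVec_mulVec, h]

/-- The operation elements of the combined channel. -/
def combinedElement (e : QubitBasis) (E : Fin 2 → Matrix (Fin 2) (Fin 2) ℂ) (n : ℕ)
    (k : Bits (2 ^ n)) : Matrix (Bits (2 ^ n)) (Bits (2 ^ n)) ℂ :=
  nCopyElement E k * encodingUnitary e n

theorem combinedChannel_eq (e : QubitBasis) (E : Fin 2 → Matrix (Fin 2) (Fin 2) ℂ) (n : ℕ) :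
    combinedChannel e E n = krausMap (combinedElement e E n) := by
  refine LinearMap.ext fun ρ => ?_
  simp [combinedChannel, krausMap_apply, combinedElement, Matrix.mul_assoc]

theorem combinedElement_mulVec_ketN (hE : ActsAsFlips e f E w) {n : ℕ} (k Q : Bits (2 ^ n)) :
    combinedElement e E n k *ᵥ ketN e Q = flipAmplitude w k • ketN f (k + encode n Q) := by
  rw [combinedElement, ← Matrix.mulVec_mulVec, encodingUnitary_mulVec_ketN,
    nCopyElement_mulVec_ketN hE]

end Action

/-! ### Tracing out the references of the later qubits -/

section Entangled

variable {R T : Type*} [Fintype R] [DecidableEq R] [Fintype T] [DecidableEq T]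
  {e f : QubitBasis} {E : Fin 2 → Matrix (Fin 2) (Fin 2) ℂ} {w : Fin 2 → ℝ} {n N : ℕ}

/-- The unnormalized superposition of `|B r t⟩|r⟩|t⟩`. -/
def entangledVec (e : QubitBasis) (B : (R → Fin 2) → (T → Fin 2) → Bits N) :
    Bits N × (R → Fin 2) × (T → Fin 2) → ℂ := fun z =>
  ∑ r, ∑ t, ketN e (B r t) z.1 * ketPi e r z.2.1 * ketPi e t z.2.2

/-- The unnormalized superposition of `|c + J r⟩|r⟩`. -/
def outputVec (e f : QubitBasis) (J : (R → Fin 2) → Bits N) (c : Bits N) :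
    Bits N × (R → Fin 2) → ℂ := fun v => ∑ r, ketN f (c + J r) v.1 * ketPi e r v.2

theorem actLeft_entangledVec (hE : ActsAsFlips e f E w)
    {B : (R → Fin 2) → (T → Fin 2) → Bits (2 ^ n)} {J : (R → Fin 2) → Bits (2 ^ n)}
    {D : (T → Fin 2) → Bits (2 ^ n)} (hB : ∀ r t, encode n (B r t) = J r + D t)
    (k v : Bits (2 ^ n)) (r : R → Fin 2) (t : T → Fin 2) :
    actLeft (combinedElement e E n k) (entangledVec e B) (v, r, t) =
      flipAmplitude w k * ∑ t', outputVec e f J (k + D t') (v, r) * ketPi e t' t := by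
  have h : ∀ Q, ∑ y, combinedElement e E n k v y * ketN e Q y =
      flipAmplitude w k * ketN f (k + encode n Q) v := fun Q =>
    congrFun (combinedElement_mulVec_ketN hE k Q) v
  calc _ = ∑ r', ∑ t', (∑ y, combinedElement e E n k v y * ketN e (B r' t') y) *
        (ketPi e r' r * ketPi e t' t) := by
        simp only [actLeft, entangledVec, Finset.mul_sum, Finset.sum_mul]
        rw [Finset.sum_comm]
        refine Finset.sum_congr rfl fun r' _ => ?_
        rw [Finset.sum_comm]
        refine Finset.sum_congr rfl fun t' _ => Finset.sum_congr rfl fun y _ => ?_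
        ring
    _ = _ := by
        simp only [h, hB, outputVec, Finset.mul_sum, Finset.sum_mul]
        rw [Finset.sum_comm]
        refine Finset.sum_congr rfl fun t' _ => Finset.sum_congr rfl fun r' _ => ?_
        rw [add_comm (J r'), add_assoc]
        ring

/-- The product vectors on the traced-out references are orthonormal, so only terms with equal t
survive and the tail becomes classical noise. Separate offsets D and D' are kept for the
off-diagonal inputs |x⟩⟨x'|. -/
theorem traceLast_combinedChannel (hE : ActsAsFlips e f E w)
    {B B' : (R → Fin 2) → (T → Fin 2) → Bits (2 ^ n)} {J : (R → Fin 2) → Bits (2 ^ n)}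
    {D D' : (T → Fin 2) → Bits (2 ^ n)} (hB : ∀ r t, encode n (B r t) = J r + D t)
    (hB' : ∀ r t, encode n (B' r t) = J r + D' t) :
    traceLast (applyLeft (combinedChannel e E n)
      (Matrix.vecMulVec (entangledVec e B) (star (entangledVec e B')))) =
      ∑ k, ∑ t, (flipProb w k : ℂ) • Matrix.vecMulVec (outputVec e f J (k + D t))
        (star (outputVec e f J (k + D' t))) := by
  rw [combinedChannel_eq, applyLeft_krausMap_vecMulVec]
  ext ⟨v, r⟩ ⟨v', r'⟩
  simp only [traceLast, LinearMap.coe_mk, AddHom.coe_mk, Matrix.of_apply, Matrix.sum_apply,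
    Matrix.vecMulVec_apply, Pi.star_apply, Matrix.smul_apply, smul_eq_mul,
    actLeft_entangledVec hE hB, actLeft_entangledVec hE hB']
  rw [Finset.sum_comm]
  refine Finset.sum_congr rfl fun k _ => ?_
  rw [← Finset.mul_sum, ← sum_mul_star_ketPi e (fun t => outputVec e f J (k + D t) (v, r))
    (fun t => outputVec e f J (k + D' t) (v', r')), ← flipAmplitude_mul_star hE.1, Finset.mul_sum]
  refine Finset.sum_congr rfl fun t _ => ?_
  rw [star_mul' (flipAmplitude w k)]
  ring

theorem sum_star_outputVec_mul (e f : QubitBasis) (J : (R → Fin 2) → Bits N) (c c' : Bits N) :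
    ∑ v, star (outputVec e f J c v) * outputVec e f J c' v =
      if c = c' then (2 : ℂ) ^ Fintype.card R else 0 := by
  rw [Fintype.sum_prod_type]
  calc _ = ∑ v, ∑ r, ketN f (c' + J r) v * star (ketN f (c + J r) v) := by
        refine Finset.sum_congr rfl fun v _ => ?_
        rw [← sum_mul_star_ketPi e]
        exact Finset.sum_congr rfl fun r _ => mul_comm _ _
    _ = ∑ r : R → Fin 2, ∑ v, star (ketPi f (c + J r) v) * ketPi f (c' + J r) v := by
        rw [Finset.sum_comm]
        exact Finset.sum_congr rfl fun r _ => Finset.sum_congr rfl fun v _ => mul_comm _ _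
    _ = _ := by
        simp only [sum_star_ketPi_mul, add_left_inj]
        simp

/-- The isometry whose columns are the normalized vectors `outputVec`. -/
def outputIsometry (e f : QubitBasis) (J : (R → Fin 2) → Bits N) :
    Matrix (Bits N × (R → Fin 2)) (Bits N) ℂ :=
  Matrix.of fun v c => (√(1 / 2) : ℂ) ^ Fintype.card R * outputVec e f J c v

theorem sqrt_half_pow_mul_star (m : ℕ) :
    (√(1 / 2) : ℂ) ^ m * star ((√(1 / 2) : ℂ) ^ m) = 1 / 2 ^ m := by
  rw [star_pow, Complex.star_def, Complex.conj_ofReal, ← mul_pow, ← Complex.ofReal_mul,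
    mul_self_sqrt (by norm_num)]
  push_cast
  rw [one_div_pow]

theorem outputIsometry_conjTranspose_mul (e f : QubitBasis) (J : (R → Fin 2) → Bits N) :
    (outputIsometry e f J)ᴴ * outputIsometry e f J = 1 := by
  ext c c'
  have h : ∀ v, star (outputIsometry e f J v c) * outputIsometry e f J v c' =
      ((√(1 / 2) : ℂ) ^ Fintype.card R * star ((√(1 / 2) : ℂ) ^ Fintype.card R)) *
        (star (outputVec e f J c v) * outputVec e f J c' v) := fun v => by
    simp only [outputIsometry, Matrix.of_apply, star_mul']
    ring
  simp only [Matrix.mul_apply, Matrix.conjTranspose_apply, h]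
  rw [← Finset.mul_sum, sqrt_half_pow_mul_star, sum_star_outputVec_mul, Matrix.one_apply]
  split_ifs <;> simp

theorem sum_flip_regroup (p : Bits N → ℂ) (D : (T → Fin 2) → Bits N) {M : Type*}
    [AddCommMonoid M] [Module ℂ M] (F : Bits N → M) :
    ∑ k, ∑ t, p k • F (k + D t) = ∑ c, (∑ t, p (c + D t)) • F c := by
  simp only [Finset.sum_smul]
  rw [Finset.sum_comm]
  conv_rhs => rw [Finset.sum_comm]
  refine Finset.sum_congr rfl fun t _ => ?_
  rw [← Equiv.sum_comp (Equiv.addRight (D t))]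
  simp only [Equiv.coe_addRight, bits_add_add_cancel]

end Entangled

/-! ### The quantum coordinate channels are random bit-flip channels with side information -/

section Split

variable {N m : ℕ} {M : Type*} [CommMonoid M]

theorem prod_before_mul_after (m : ℕ) (g : Fin N → M) :
    (∏ j : {j : Fin N // (j : ℕ) < m}, g j) * ∏ j : {j : Fin N // m ≤ (j : ℕ)}, g j = ∏ j, g j := by
  rw [← Finset.prod_subtype (Finset.univ.filter fun j : Fin N => (j : ℕ) < m) (by simp) g,
    ← Finset.prod_subtype (Finset.univ.filter fun j : Fin N => m ≤ (j : ℕ)) (by simp) g,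
    ← Finset.prod_filter_mul_prod_filter_not Finset.univ (fun j : Fin N => (j : ℕ) < m) g]
  simp only [not_lt]

theorem prod_before_mul_after_mul (i : Fin N) (g : Fin N → M) :
    (∏ j : {j : Fin N // (j : ℕ) < i}, g j) * (∏ j : {j : Fin N // (i : ℕ) + 1 ≤ (j : ℕ)}, g j) *
      g i = ∏ j, g j := by
  rw [← prod_before_mul_after i g, mul_assoc]
  congr 1
  have h : ∀ j : Fin N, j ∈ (Finset.univ.filter fun j : Fin N => (i : ℕ) + 1 ≤ (j : ℕ)) ↔
      (i : ℕ) + 1 ≤ (j : ℕ) := by simp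
  have h' : ∀ j : Fin N, j ∈ insert i (Finset.univ.filter fun j : Fin N => (i : ℕ) + 1 ≤ (j : ℕ)) ↔
      (i : ℕ) ≤ (j : ℕ) := by
    intro j
    simp only [Finset.mem_insert, Finset.mem_filter, Finset.mem_univ, true_and, Fin.ext_iff]
    omega
  rw [← Finset.prod_subtype _ h g, ← Finset.prod_subtype _ h' g, Finset.prod_insert (by simp),
    mul_comm]

end Split

section Coordinate

variable {e f : QubitBasis} {E : Fin 2 → Matrix (Fin 2) (Fin 2) ℂ} {w : Fin 2 → ℝ} {n : ℕ}

theorem bell_join_eq_entangledVec (e : QubitBasis) (N m : ℕ) :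
    (fun z : Bits N × Before N m × After N m => ∏ j, bell e (z.1 j) (join z.2.1 z.2.2 j)) =
      (√(1 / 2) : ℂ) ^ N • entangledVec e join := by
  funext ⟨q, r, t⟩
  rw [prod_bell e q (join r t), Fintype.card_fin, Pi.smul_apply, smul_eq_mul, entangledVec,
    ← Equiv.sum_comp (joinEquiv N m), Fintype.sum_prod_type]
  congr 1
  refine Finset.sum_congr rfl fun r' _ => Finset.sum_congr rfl fun t' _ => ?_
  have h : ketPi e (join r' t') (join r t) = ketPi e r' r * ketPi e t' t := by
    rw [ketPi, ← prod_before_mul_after m]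
    congr 1
    · refine Finset.prod_congr rfl fun j _ => ?_
      simp [join, j.2]
    · refine Finset.prod_congr rfl fun j _ => ?_
      simp [join, not_lt.2 j.2]
  change ketPi e (join r' t') q * ketPi e (join r' t') (join r t) = _
  rw [h, mul_assoc]
  rfl

theorem coordinateInput_ket (e : QubitBasis) {N : ℕ} (i : Fin N) (x x' : Fin 2) :
    coordinateInput e i (Matrix.vecMulVec (ket e x) (star (ket e x'))) =
      ((1 / 2 ^ (N - 1) : ℝ) : ℂ) • Matrix.vecMulVec (entangledVec e fun r t => join₃ i r x t)
        (star (entangledVec e fun r t => join₃ i r x' t)) := by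
  have hcard : Fintype.card {j : Fin N // (j : ℕ) < i} +
      Fintype.card {j : Fin N // (i : ℕ) + 1 ≤ (j : ℕ)} = N - 1 := by
    rw [card_lt_subtype i.2.le, card_le_subtype]
    have := i.2
    omega
  have key : ∀ (x : Fin 2) (z : Bits N × Before N i × After N (i + 1)),
      ket e x (z.1 i) * ((∏ j, bell e (z.1 j.1) (z.2.1 j)) * ∏ j, bell e (z.1 j.1) (z.2.2 j)) =
        (√(1 / 2) : ℂ) ^ (N - 1) * entangledVec e (fun r t => join₃ i r x t) z := by
    rintro x ⟨q, r, t⟩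
    simp only
    rw [prod_bell e (fun j : {j : Fin N // (j : ℕ) < i} => q j) r,
      prod_bell e (fun j : {j : Fin N // (i : ℕ) + 1 ≤ (j : ℕ)} => q j) t, mul_mul_mul_comm,
      ← pow_add, hcard, Finset.sum_mul_sum, entangledVec, mul_left_comm, Finset.mul_sum]
    congr 1
    refine Finset.sum_congr rfl fun r' _ => ?_
    rw [Finset.mul_sum]
    refine Finset.sum_congr rfl fun t' _ => ?_
    have h : ketN e (join₃ i r' x t') q = ketPi e r' (fun j => q j) * ketPi e t' (fun j => q j) *
        ket e x (q i) := by
      rw [ketN, ← prod_before_mul_after_mul i]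
      congr 1
      · congr 1
        · refine Finset.prod_congr rfl fun j _ => ?_
          simp [join₃, j.2]
        · refine Finset.prod_congr rfl fun j _ => ?_
          have h1 : ¬ (j : ℕ) < i := by have := j.2; omega
          have h2 : (i : ℕ) < (j : ℕ) := j.2
          simp [join₃, h1, h2]
      · simp [join₃]
    rw [h]
    ring
  ext z z'
  rw [Matrix.smul_apply, Matrix.vecMulVec_apply, Pi.star_apply, smul_eq_mul]
  have hs := sqrt_half_pow_mul_star (N - 1)
  calc _ = (ket e x (z.1 i) *
        ((∏ j, bell e (z.1 j.1) (z.2.1 j)) * ∏ j, bell e (z.1 j.1) (z.2.2 j))) *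
        star (ket e x' (z'.1 i) *
          ((∏ j, bell e (z'.1 j.1) (z'.2.1 j)) * ∏ j, bell e (z'.1 j.1) (z'.2.2 j))) := by
        simp only [coordinateInput, LinearMap.coe_mk, AddHom.coe_mk, Matrix.of_apply,
          Matrix.vecMulVec_apply, Pi.star_apply, star_mul']
        ring
    _ = _ := by
        rw [key, key, star_mul', mul_mul_mul_comm, hs]
        push_cast
        rfl

/-- The encoded first part of a bit string. -/
def encodeBefore (n m : ℕ) (r : Before (2 ^ n) m) : Bits (2 ^ n) := encode n (join r 0)

/-- Flips and tail only add to c = k + (tail)G_N, and the vectors ∑_r |c + J r⟩|r⟩ are orthogonal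
for distinct c because the registers |r⟩ are. -/
theorem outputState_eq (hE : ActsAsFlips e f E w) {m : ℕ} (hm : m ≤ 2 ^ n) :
    outputState e E n m = outputIsometry e f (encodeBefore n m) *
      Matrix.diagonal (fun c => (tailDist w n m c : ℂ)) *
        (outputIsometry e f (encodeBefore n m))ᴴ := by
  have hB : ∀ (r : Before (2 ^ n) m) t, encode n (join r t) =
      encodeBefore n m r + encode n (join 0 t) := fun r t => by
    rw [join_eq_add, encode_add]; rfl
  have h1 : proj ((√(1 / 2) : ℂ) ^ 2 ^ n • entangledVec e (join (N := 2 ^ n) (m := m))) =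
      (1 / 2 ^ 2 ^ n : ℂ) • Matrix.vecMulVec (entangledVec e join) (star (entangledVec e join)) := by
    rw [proj, star_smul, Matrix.smul_vecMulVec, Matrix.vecMulVec_smul, smul_smul,
      sqrt_half_pow_mul_star]
  rw [outputState, bell_join_eq_entangledVec, h1, map_smul, map_smul,
    traceLast_combinedChannel hE hB hB,
    sum_flip_regroup (fun k => (flipProb w k : ℂ)) (fun t => encode n (join 0 t)) fun c =>
      Matrix.vecMulVec (outputVec e f (encodeBefore n m) c)
        (star (outputVec e f (encodeBefore n m) c))]
  ext v v'
  rw [Matrix.mul_apply]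
  simp only [Matrix.smul_apply, Matrix.sum_apply, smul_eq_mul, Matrix.mul_diagonal,
    Matrix.conjTranspose_apply, Finset.mul_sum, Matrix.vecMulVec_apply, Pi.star_apply]
  refine Finset.sum_congr rfl fun c _ => ?_
  have hs := sqrt_half_pow_mul_star m
  rw [tailDist_eq_sum_after w hm]
  simp only [outputIsometry, Matrix.of_apply, card_lt_subtype hm, star_mul']
  -- The factor 2^m counts the masked prefixes in `tailDist`; 1/2^m normalizes the columns of
  -- `outputIsometry`.
  calc _ = (2 ^ m * (1 / 2 ^ m) : ℂ) * (1 / 2 ^ 2 ^ n * ((∑ t : After (2 ^ n) m,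
        (flipProb w (c + encode n (join 0 t)) : ℂ)) * (outputVec e f (encodeBefore n m) c v *
          star (outputVec e f (encodeBefore n m) c v')))) := by
        rw [mul_one_div_cancel (by positivity), one_mul]
    _ = _ := by
        rw [← hs]
        push_cast
        ring

theorem vonNeumannEntropy_outputState (hE : ActsAsFlips e f E w) {m : ℕ} (hm : m ≤ 2 ^ n) :
    vonNeumannEntropy (outputState e E n m) = shannonEntropy (tailDist w n m) := by
  rw [outputState_eq hE hm, vonNeumannEntropy_eq_spectralEntropy,
    spectralEntropy_isometry (outputIsometry_conjTranspose_mul e f _), spectralEntropy_diagonal]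
  refine Matrix.isHermitian_mul_mul_conjTranspose _ ?_
  refine Matrix.isHermitian_diagonal_of_self_adjoint _ ?_
  funext c
  exact Complex.conj_ofReal _

theorem linearMap_ext_ket {M : Type*} [AddCommGroup M] [Module ℂ M] (e : QubitBasis)
    {Φ Ψ : Matrix (Fin 2) (Fin 2) ℂ →ₗ[ℂ] M}
    (h : ∀ x x', Φ (Matrix.vecMulVec (ket e x) (star (ket e x'))) =
      Ψ (Matrix.vecMulVec (ket e x) (star (ket e x')))) : Φ = Ψ := by
  refine LinearMap.ext fun ρ => ?_
  have hρ : ρ = ∑ x, ∑ x', ((basisMatrix e)ᴴ * ρ * basisMatrix e) x x' •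
      Matrix.vecMulVec (ket e x) (star (ket e x')) := by
    have h1 : ρ = basisMatrix e * ((basisMatrix e)ᴴ * ρ * basisMatrix e) * (basisMatrix e)ᴴ := by
      simp only [← Matrix.mul_assoc, basisMatrix_mul_conjTranspose, Matrix.one_mul]
      rw [Matrix.mul_assoc, basisMatrix_mul_conjTranspose, Matrix.mul_one]
    conv_lhs => rw [h1]
    generalize (basisMatrix e)ᴴ * ρ * basisMatrix e = σ
    ext y y'
    simp only [Matrix.mul_apply, Matrix.sum_apply, Matrix.smul_apply, Matrix.vecMulVec_apply,
      basisMatrix, Matrix.of_apply, Matrix.conjTranspose_apply, Pi.star_apply, smul_eq_mul,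
      Finset.sum_mul]
    rw [Finset.sum_comm]
    refine Finset.sum_congr rfl fun x _ => Finset.sum_congr rfl fun x' _ => ?_
    ring
  rw [hρ]
  simp only [map_sum, map_smul, h]

theorem shiftElement_mulVec_ket {b S : Type*} [Fintype b] [DecidableEq b] [Fintype S]
    [DecidableEq S] (V : Matrix b (Fin 2 × S) ℂ) (e : QubitBasis) (q : Fin 2 × S → ℝ)
    (c : Fin 2 × S) (x : Fin 2) :
    shiftElement V e q c *ᵥ ket e x = (√(q c) : ℂ) • fun v => V v (c.1 + x, c.2) := by
  have h1 : (basisMatrix e)ᴴ *ᵥ ket e x = Pi.single x 1 := by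
    funext y
    simp only [Matrix.mulVec, dotProduct, Matrix.conjTranspose_apply, basisMatrix, Matrix.of_apply,
      Pi.single_apply, sum_star_ket_mul_ket, eq_comm]
  rw [shiftElement, ← Matrix.mulVec_mulVec, ← Matrix.mulVec_mulVec, h1, Matrix.mulVec_single_one]
  funext v
  simp only [Matrix.mulVec, dotProduct, Matrix.col_apply, shiftMatrix, Matrix.of_apply, mul_ite,
    mul_zero, Finset.sum_ite_eq', Finset.mem_univ, if_true, Pi.smul_apply, smul_eq_mul, mul_comm]

theorem krausMap_shiftElement_ket {b S : Type*} [Fintype b] [DecidableEq b] [Fintype S]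
    [DecidableEq S] (V : Matrix b (Fin 2 × S) ℂ) (e : QubitBasis) {q : Fin 2 × S → ℝ}
    (hq : ∀ c, 0 ≤ q c) (x x' : Fin 2) :
    krausMap (shiftElement V e q) (Matrix.vecMulVec (ket e x) (star (ket e x'))) =
      ∑ c, (q c : ℂ) • Matrix.vecMulVec (fun v => V v (c.1 + x, c.2))
        (star fun v => V v (c.1 + x', c.2)) := by
  rw [krausMap_apply]
  refine Finset.sum_congr rfl fun c _ => ?_
  rw [Matrix.mul_vecMulVec, Matrix.vecMulVec_mul, ← Matrix.star_mulVec, shiftElement_mulVec_ket,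
    shiftElement_mulVec_ket, star_smul, Matrix.smul_vecMulVec, Matrix.vecMulVec_smul, smul_smul,
    Complex.star_def, Complex.conj_ofReal, ← Complex.ofReal_mul, mul_self_sqrt (hq c)]

/-- Bit strings as pairs of a coset of `{0, g}` and a bit. -/
theorem exists_coset_equiv {N : ℕ} {g : Bits N} (hg : g ≠ 0) :
    ∃ (S : Type) (_ : Fintype S) (_ : DecidableEq S) (γ : Fin 2 × S ≃ Bits N),
      ∀ z x s, γ (z + x, s) = γ (z, s) + x • g := by
  obtain ⟨j, hj⟩ := Function.ne_iff.1 hg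
  have hj1 : g j = 1 := by
    have h : ∀ x : Fin 2, x ≠ 0 → x = 1 := by decide
    exact h _ hj
  -- At a position j where g is 1, each coset of {0, g} has exactly one member vanishing at j; the
  -- bit at j tells the two members apart.
  refine ⟨{c : Bits N // c j = 0}, inferInstance, inferInstance,
    { toFun := fun p => p.2 + p.1 • g
      invFun := fun c => (c j, ⟨c + c j • g, by simp [hj1, fin_two_add_self]⟩)
      left_inv := ?_
      right_inv := ?_ }, ?_⟩
  · rintro ⟨z, s, hs⟩
    have : s j + z * g j = z := by rw [hs, hj1, zero_add, mul_one]
    simp [this, bits_add_add_cancel]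
  · intro c
    exact bits_add_add_cancel c _
  · intro z x s
    funext k
    simp [add_mul, add_assoc]

/-- By linearity of the encoding the input bit acts as a translation by x times a row of G_N. The
later qubits only add noise common to x and x', so coherence between the two inputs survives. -/
theorem coordinateChannel_ket (hE : ActsAsFlips e f E w) (i : Fin (2 ^ n)) (x x' : Fin 2) :
    coordinateChannel e E n i (Matrix.vecMulVec (ket e x) (star (ket e x'))) =
      ∑ c, (tailDist w n (i + 1) c : ℂ) •
        Matrix.vecMulVec
          (fun v => outputIsometry e f (encodeBefore n i) v (c + x • generatorRow n i))
          (star fun v => outputIsometry e f (encodeBefore n i) v (c + x' • generatorRow n i)) := by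
  have hB : ∀ (x : Fin 2) (r : Before (2 ^ n) i) t, encode n (join₃ i r x t) =
      encodeBefore n i r + (encode n (join 0 t) + x • generatorRow n i) :=
    fun x r t => encode_join₃ i r x t
  rw [coordinateChannel, LinearMap.comp_apply, LinearMap.comp_apply, coordinateInput_ket, map_smul,
    map_smul, traceLast_combinedChannel hE (hB x) (hB x')]
  simp only [← add_assoc]
  rw [sum_flip_regroup (fun k => (flipProb w k : ℂ))
    (fun t : After (2 ^ n) (i + 1) => encode n (join 0 t)) fun c =>
      Matrix.vecMulVec (outputVec e f (encodeBefore n i) (c + x • generatorRow n i))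
        (star (outputVec e f (encodeBefore n i) (c + x' • generatorRow n i)))]
  ext v v'
  simp only [Matrix.smul_apply, Matrix.sum_apply, smul_eq_mul, Finset.mul_sum,
    Matrix.vecMulVec_apply, Pi.star_apply]
  refine Finset.sum_congr rfl fun c _ => ?_
  have hs := sqrt_half_pow_mul_star (i : ℕ)
  have hpow : (2 : ℂ) ^ 2 ^ n = 2 ^ (2 ^ n - 1) * 2 := by
    rw [← pow_succ, Nat.sub_add_cancel Nat.one_le_two_pow]
  rw [tailDist_eq_sum_after w (Nat.succ_le_of_lt i.2)]
  simp only [outputIsometry, Matrix.of_apply, card_lt_subtype i.2.le, star_mul']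
  set Z := outputVec e f (encodeBefore n i) (c + x • generatorRow n i) v
  set Z' := outputVec e f (encodeBefore n i) (c + x' • generatorRow n i) v'
  calc _ = (2 ^ (i : ℕ) * (1 / 2 ^ (i : ℕ)) : ℂ) * (1 / 2 ^ (2 ^ n - 1) *
        ((∑ t : After (2 ^ n) (i + 1), (flipProb w (c + encode n (join 0 t)) : ℂ)) *
          (Z * star Z'))) := by
        rw [mul_one_div_cancel (by positivity), one_mul]
        push_cast
        rfl
    _ = _ := by
        rw [← hs]
        push_cast
        rw [hpow, pow_succ (2 : ℂ)]
        field_simp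

/-- Indexing strings by (bit, coset of the row) exhibits the channel as a labelled bit flip.
Averaging its weights over the bit is the passage from `tailDist` at i + 1 to `tailDist` at i. -/
theorem coherentInfo_coordinateChannel (hE : ActsAsFlips e f E w) (i : Fin (2 ^ n)) :
    (∀ ρ, IsDensity ρ → coherentInfo ρ (coordinateChannel e E n i) ≤ coordinateInfo w n i) ∧
      coherentInfo completelyMixed (coordinateChannel e E n i) = coordinateInfo w n i := by
  obtain ⟨S, _, _, γ, hγ⟩ := exists_coset_equiv (generatorRow_ne_zero n i)
  set V := (outputIsometry e f (encodeBefore n i)).submatrix id γ with hVdef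
  have hV : Vᴴ * V = 1 := by
    rw [hVdef, Matrix.conjTranspose_submatrix, ← Matrix.submatrix_mul _ _ _ _ _ Function.bijective_id,
      outputIsometry_conjTranspose_mul, Matrix.submatrix_one_equiv]
  set q : Fin 2 × S → ℝ := fun d => tailDist w n (i + 1) (γ d) with hqdef
  have hq : ∀ d, 0 ≤ q d := fun d => tailDist_nonneg hE.1 _ _
  have hΦ : coordinateChannel e E n i = krausMap (shiftElement V e q) := by
    refine linearMap_ext_ket e fun x x' => ?_
    rw [coordinateChannel_ket hE, krausMap_shiftElement_ket V e hq, ← Equiv.sum_comp γ]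
    refine Finset.sum_congr rfl fun d _ => ?_
    simp only [hVdef, hqdef, Matrix.submatrix_apply, id, hγ]
  have hinfo : shannonEntropy (shiftAverage q) - shannonEntropy q = coordinateInfo w n i := by
    rw [coordinateInfo, ← shannonEntropy_comp_equiv γ, ← shannonEntropy_comp_equiv γ]
    congr 2
    funext d
    rw [tailDist_succ, shiftAverage]
    simp only [hqdef, hγ, one_smul]
  rw [hΦ, ← hinfo]
  exact ⟨fun ρ hρ => coherentInfo_shiftElement_le hV e hq hρ,
    coherentInfo_shiftElement_completelyMixed hV e hq⟩

/-- The single channel is a bit flip with trivial label. Its output space is a qubit rather than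
`Bits (2 ^ 0)` with an empty reference register, so the reduction is repeated for it. -/
theorem mslci_krausMap (hE : ActsAsFlips e f E w) : mslci (krausMap E) = coordinateInfo w 0 0 := by
  let γ : Fin 2 × Unit ≃ Bits (2 ^ 0) :=
    (Equiv.prodUnique (Fin 2) Unit).trans (Equiv.funUnique (Fin 1) (Fin 2)).symm
  have hγ : ∀ d j, γ d j = d.1 := fun d j => rfl
  set V : Matrix (Fin 2) (Fin 2 × Unit) ℂ := (basisMatrix f).submatrix id Prod.fst with hVdef
  have hV : Vᴴ * V = 1 := by
    rw [hVdef, Matrix.conjTranspose_submatrix,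
      ← Matrix.submatrix_mul _ _ _ _ _ Function.bijective_id, basisMatrix_conjTranspose_mul]
    exact Matrix.submatrix_one_equiv (Equiv.prodUnique (Fin 2) Unit)
  set q : Fin 2 × Unit → ℝ := fun d => w d.1 with hqdef
  have hq : ∀ d, 0 ≤ q d := fun d => hE.1 _
  have hΦ : krausMap E = krausMap (shiftElement V e q) := by
    refine linearMap_ext_ket e fun x x' => ?_
    rw [krausMap_shiftElement_ket V e hq, krausMap_apply, Fintype.sum_prod_type]
    refine Finset.sum_congr rfl fun k _ => ?_
    rw [Matrix.mul_vecMulVec, Matrix.vecMulVec_mul, ← Matrix.star_mulVec, hE.2, hE.2, star_smul,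
      Matrix.smul_vecMulVec, Matrix.vecMulVec_smul, smul_smul, Complex.star_def,
      Complex.conj_ofReal, ← Complex.ofReal_mul, mul_self_sqrt (hE.1 k)]
    simp [hqdef, hVdef]
    rfl
  have hinfo : shannonEntropy (shiftAverage q) - shannonEntropy q = coordinateInfo w 0 0 := by
    have h1 : ∀ c : Bits (2 ^ 0), tailDist w 0 1 c = w (c 0) := fun c => by
      rw [tailDist_of_le (by norm_num)]
      simp [flipProb]
    rw [coordinateInfo, ← shannonEntropy_comp_equiv γ, ← shannonEntropy_comp_equiv γ]
    congr 2
    · funext d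
      have h2 := tailDist_succ (w := w) (0 : Fin (2 ^ 0)) (γ d)
      rw [Fin.val_zero, zero_add, h1, h1] at h2
      rw [h2]
      rfl
    · funext d
      change w d.1 = tailDist w 0 1 (γ d)
      exact (h1 (γ d)).symm
  have hmax := coherentInfo_shiftElement_completelyMixed hV e hq
  rw [hΦ, (isMaxOn_and_mslci_eq fun ρ hρ => hmax ▸ coherentInfo_shiftElement_le hV e hq hρ).2, hmax,
    hinfo]

end Coordinate

/-! ### The classical coordinate channels -/

section SymmetricChannel

variable {b : Type*} [Fintype b] {P : Fin 2 → b → ℝ} {τ : Equiv.Perm b}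

/-- The two rows are permutations of each other, so the conditional entropy of the output does not
depend on the input distribution. -/
theorem mutualInfo_eq_sub (hτ : ∀ z, P 1 z = P 0 (τ z)) (h1 : ∑ z, P 0 z = 1) {p : Fin 2 → ℝ}
    (hp : ∑ x, p x = 1) :
    mutualInfo p P = shannonEntropy (fun z => ∑ x, p x * P x z) - shannonEntropy (P 0) := by
  have hsum : ∀ x, ∑ z, P x z = 1 := by
    intro x
    fin_cases x
    · exact h1
    · change ∑ z, P 1 z = 1
      simp only [hτ]
      rwa [Equiv.sum_comp τ (P 0)]
  have hent : ∀ x, ∑ z, negMulLog (P x z) = ∑ z, negMulLog (P 0 z) := by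
    intro x
    fin_cases x
    · rfl
    · change ∑ z, negMulLog (P 1 z) = _
      simp only [hτ]
      exact Equiv.sum_comp τ fun z => negMulLog (P 0 z)
  have hjoint : shannonEntropy (fun z : Fin 2 × b => p z.1 * P z.1 z.2) =
      shannonEntropy p + shannonEntropy (P 0) := by
    simp only [shannonEntropy_eq_div, Fintype.sum_prod_type, negMulLog_mul, Finset.sum_add_distrib,
      ← Finset.sum_mul, ← Finset.mul_sum, hsum, hent, hp, one_mul, add_div]
  rw [mutualInfo, hjoint]
  ring

theorem symmetricCapacity_eq (hτ : ∀ z, P 1 z = P 0 (τ z)) (h1 : ∑ z, P 0 z = 1) :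
    symmetricCapacity P = shannonEntropy (symmetrize τ (P 0)) - shannonEntropy (P 0) := by
  rw [symmetricCapacity, mutualInfo_eq_sub hτ h1 (by norm_num)]
  congr 2
  funext z
  rw [Fin.sum_univ_two, hτ, symmetrize]
  ring

/-- Symmetrizing the output distribution of any input under τ yields that of the uniform input, and
symmetrizing does not lower the entropy. -/
theorem shannonCapacity_eq_symmetricCapacity (hττ : ∀ z, τ (τ z) = z)
    (hτ : ∀ z, P 1 z = P 0 (τ z)) (h0 : ∀ z, 0 ≤ P 0 z) (h1 : ∑ z, P 0 z = 1) :
    shannonCapacity P = symmetricCapacity P := by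
  refine IsGreatest.csSup_eq ⟨⟨fun _ => 1 / 2, ?_, rfl⟩, ?_⟩
  · exact ⟨fun _ => by norm_num, by norm_num⟩
  · rintro _ ⟨p, ⟨hp0, hp⟩, rfl⟩
    simp only
    rw [mutualInfo_eq_sub hτ h1 hp, symmetricCapacity_eq hτ h1]
    refine sub_le_sub_right ((shannonEntropy_le_symmetrize τ fun z => ?_).trans_eq ?_) _
    · rw [Fin.sum_univ_two, hτ]
      exact add_nonneg (mul_nonneg (hp0 0) (h0 z)) (mul_nonneg (hp0 1) (h0 _))
    · rw [Fin.sum_univ_two] at hp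
      congr 1
      funext z
      simp only [symmetrize, Fin.sum_univ_two, hτ, hττ]
      have : p 1 = 1 - p 0 := by linarith
      rw [this]
      ring

end SymmetricChannel

section Classical

variable {W : Matrix (Fin 2) (Fin 2) ℝ} {w : Fin 2 → ℝ} {n : ℕ}

/-- The noise is output plus codeword, and summing over the later bits gives the tail distribution.
The constants match because 2^{-(N-1)} = (2^{i+1}/2^N) · 2^{-i}. -/
theorem coordinateClassical_eq (hW : ∀ a b, W a b = w (a + b)) (i : Fin (2 ^ n)) (x : Fin 2)
    (z : Bits (2 ^ n) × Before (2 ^ n) i) :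
    coordinateClassical W n i x z =
      tailDist w n (i + 1) (z.1 + encodeBefore n i z.2 + x • generatorRow n i) *
        (1 / 2 ^ (i : ℕ)) := by
  have h : ∀ t : After (2 ^ n) (i + 1), combinedClassical W n (join₃ i z.2 x t) z.1 =
      flipProb w (z.1 + encodeBefore n i z.2 + x • generatorRow n i + encode n (join 0 t)) := by
    intro t
    have hc : z.1 + encodeBefore n i z.2 + x • generatorRow n i + encode n (join 0 t) =
        encode n (join₃ i z.2 x t) + z.1 := by
      rw [encode_join₃, encodeBefore]
      abel
    rw [hc, combinedClassical, flipProb]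
    exact Finset.prod_congr rfl fun j _ => hW _ _
  have hpow : (2 : ℝ) ^ 2 ^ n = 2 ^ (2 ^ n - 1) * 2 := by
    rw [← pow_succ, Nat.sub_add_cancel Nat.one_le_two_pow]
  rw [coordinateClassical, tailDist_eq_sum_after w (Nat.succ_le_of_lt i.2), ← Finset.mul_sum,
    hpow, pow_succ (2 : ℝ)]
  simp only [h]
  field_simp

theorem card_before (i : Fin (2 ^ n)) : Fintype.card (Before (2 ^ n) i) = 2 ^ (i : ℕ) := by
  rw [Fintype.card_fun, card_lt_subtype i.2.le, Fintype.card_fin]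

/-- The bijection `(y, r) ↦ (y + (r, 0) G_N, r)`. -/
def addEncodeBefore (n : ℕ) (i : Fin (2 ^ n)) :
    Bits (2 ^ n) × Before (2 ^ n) i ≃ Bits (2 ^ n) × Before (2 ^ n) i where
  toFun z := (z.1 + encodeBefore n i z.2, z.2)
  invFun z := (z.1 + encodeBefore n i z.2, z.2)
  left_inv _ := Prod.ext (bits_add_add_cancel _ _) rfl
  right_inv _ := Prod.ext (bits_add_add_cancel _ _) rfl

theorem capacities_coordinateClassical (hw : ∀ x, 0 ≤ w x) (hw1 : ∑ x, w x = 1)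
    (hW : ∀ a b, W a b = w (a + b)) (i : Fin (2 ^ n)) :
    symmetricCapacity (coordinateClassical W n i) = coordinateInfo w n i ∧
      shannonCapacity (coordinateClassical W n i) =
        symmetricCapacity (coordinateClassical W n i) := by
  set u : Before (2 ^ n) i → ℝ := fun _ => 1 / 2 ^ (i : ℕ) with hu
  have hu1 : ∑ r, u r = 1 := by
    simp only [hu, Finset.sum_const, Finset.card_univ, card_before, nsmul_eq_mul]
    push_cast
    exact mul_one_div_cancel (by positivity)
  have hP0 : ∀ z, coordinateClassical W n i 0 z =
      tailDist w n (i + 1) (addEncodeBefore n i z).1 * u (addEncodeBefore n i z).2 := fun z => by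
    rw [coordinateClassical_eq hW, zero_smul, add_zero]
    rfl
  let τ : Equiv.Perm (Bits (2 ^ n) × Before (2 ^ n) i) :=
    (rowShift n i).prodCongr (Equiv.refl _)
  have hττ : ∀ z, τ (τ z) = z := fun z => Prod.ext (rowShift_rowShift n i z.1) rfl
  have hτadd : ∀ z, addEncodeBefore n i (τ z) =
      ((addEncodeBefore n i z).1 + generatorRow n i, (addEncodeBefore n i z).2) := fun z =>
    Prod.ext (add_right_comm _ _ _) rfl
  have hτ : ∀ z, coordinateClassical W n i 1 z = coordinateClassical W n i 0 (τ z) := fun z => by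
    rw [hP0, hτadd, coordinateClassical_eq hW, one_smul]
    rfl
  have h0 : ∀ z, 0 ≤ coordinateClassical W n i 0 z := fun z => by
    rw [hP0]
    exact mul_nonneg (tailDist_nonneg hw _ _) (by positivity)
  have h1 : ∑ z, coordinateClassical W n i 0 z = 1 := by
    simp only [hP0]
    rw [Equiv.sum_comp (addEncodeBefore n i) fun z => tailDist w n (i + 1) z.1 * u z.2,
      Fintype.sum_prod_type, ← Finset.sum_mul_sum, sum_tailDist hw1, hu1, one_mul]
  have hH : ∀ m, shannonEntropy (fun z => tailDist w n m (addEncodeBefore n i z).1 *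
      u (addEncodeBefore n i z).2) = shannonEntropy (tailDist w n m) + shannonEntropy u :=
    fun m => by
      rw [shannonEntropy_comp_equiv (addEncodeBefore n i) fun z => tailDist w n m z.1 * u z.2,
        shannonEntropy_prod (sum_tailDist hw1 m) hu1]
  refine ⟨?_, shannonCapacity_eq_symmetricCapacity hττ hτ h0 h1⟩
  have hsym : symmetrize τ (coordinateClassical W n i 0) = fun z =>
      tailDist w n i (addEncodeBefore n i z).1 * u (addEncodeBefore n i z).2 := by
    funext z
    rw [symmetrize, hP0, hP0, hτadd, tailDist_succ]
    ring
  -- The earlier bits are uniform and, after the change of variables, independent of the noise;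
  -- their entropy cancels in the difference.
  rw [symmetricCapacity_eq hτ h1, hsym, hH, funext hP0, hH, coordinateInfo]
  ring

end Classical

/-! ### Reading off the flip weights, and assembling the theorem -/

theorem exists_flip_weights {e f : QubitBasis} {A W : Matrix (Fin 2) (Fin 2) ℝ}
    {E : Fin 2 → Matrix (Fin 2) (Fin 2) ℂ} (hE : IsQSC e f A E) (hW : IsBSC W) (hAW : A = W) :
    ∃ w : Fin 2 → ℝ, ActsAsFlips e f E w ∧ ∑ x, w x = 1 ∧ ∀ a b, W a b = w (a + b) := by
  obtain ⟨p, hp0, hp1, rfl⟩ := hW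
  subst hAW
  refine ⟨![1 - p, p], ⟨?_, fun k i => ?_⟩, ?_, ?_⟩
  · intro x
    fin_cases x
    · exact sub_nonneg.2 hp1
    · exact hp0
  · rw [hE.elements k i]
    congr 3
    fin_cases k <;> fin_cases i <;> rfl
  · simp
  · intro a b
    fin_cases a <;> fin_cases b <;> rfl

theorem card_subtype_eq_sum_indicator {N : ℕ} (x : Fin N → ℝ) (s : Set ℝ) :
    (Nat.card {i // x i ∈ s} : ℝ) = ∑ i, s.indicator 1 (x i) := by
  classical
  rw [Nat.card_eq_fintype_card, Fintype.card_subtype]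
  simp [Set.indicator_apply]

end QuantumPolar

end

theorem theorem7 (e f : QubitBasis) (A W : Matrix (Fin 2) (Fin 2) ℝ)
    (E : Fin 2 → Matrix (Fin 2) (Fin 2) ℂ)
    (hE : IsQSC e f A E) (hW : IsBSC W) (hAW : A = W) :
    (∀ (n : ℕ) (i : Fin (2 ^ n)),
      IsMaxOn (fun ρ => coherentInfo ρ (coordinateChannel e E n i)) {ρ | IsDensity ρ}
        completelyMixed ∧
      mslci (coordinateChannel e E n i) =
        coherentInfo completelyMixed (coordinateChannel e E n i) ∧
      coherentInfo completelyMixed (coordinateChannel e E n i) =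
        vonNeumannEntropy (outputState e E n i) - vonNeumannEntropy (outputState e E n (i + 1)) ∧
      coherentInfo completelyMixed (coordinateChannel e E n i) =
        symmetricCapacity (coordinateClassical W n i) ∧
      shannonCapacity (coordinateClassical W n i) =
        symmetricCapacity (coordinateClassical W n i)) ∧
    (∀ δ : ℝ, 0 < δ → δ < 1 →
      Tendsto (fun n : ℕ =>
          (Nat.card {i : Fin (2 ^ n) //
            mslci (coordinateChannel e E n i) ∈ Set.Ioc (1 - δ) 1} : ℝ) / 2 ^ n)
        atTop (𝓝 (mslci (krausMap E))) ∧
      Tendsto (fun n : ℕ =>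
          (Nat.card {i : Fin (2 ^ n) //
            mslci (coordinateChannel e E n i) ∈ Set.Ico 0 δ} : ℝ) / 2 ^ n)
        atTop (𝓝 (1 - mslci (krausMap E)))) := by
  obtain ⟨w, hF, hw1, hWw⟩ := exists_flip_weights hE hW hAW
  have hco : ∀ (n : ℕ) (i : Fin (2 ^ n)),
      coherentInfo completelyMixed (coordinateChannel e E n i) = coordinateInfo w n i :=
    fun n i => (coherentInfo_coordinateChannel hF i).2
  have hmax : ∀ (n : ℕ) (i : Fin (2 ^ n)),
      IsMaxOn (fun ρ => coherentInfo ρ (coordinateChannel e E n i)) {ρ | IsDensity ρ}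
        completelyMixed ∧
      mslci (coordinateChannel e E n i) =
        coherentInfo completelyMixed (coordinateChannel e E n i) := fun n i =>
    isMaxOn_and_mslci_eq fun ρ hρ => by
      rw [hco]
      exact (coherentInfo_coordinateChannel hF i).1 ρ hρ
  refine ⟨fun n i => ⟨(hmax n i).1, (hmax n i).2, ?_, ?_, ?_⟩, fun δ hδ0 hδ1 => ?_⟩
  · rw [hco, vonNeumannEntropy_outputState hF i.2.le,
      vonNeumannEntropy_outputState hF (Nat.succ_le_of_lt i.2), coordinateInfo]
  · rw [hco, (capacities_coordinateClassical hF.1 hw1 hWw i).1]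
  · exact (capacities_coordinateClassical hF.1 hw1 hWw i).2
  simp only [fun n i => (hmax n i).2.trans (hco n i), mslci_krausMap hF,
    card_subtype_eq_sum_indicator fun i : Fin (2 ^ _) => coordinateInfo w _ i]
  -- For both intervals the test function must be 0 on [0, γ) and 1 on (1 - γ, 1], which requires γ
  -- ≤ δ and γ ≤ 1 - δ.
  have hγ : 0 < min δ (1 - δ) := lt_min hδ0 (sub_pos.2 hδ1)
  constructor
  · refine tendsto_average_coordinateInfo hF.1 hw1 (χ := (Set.Ioc (1 - δ) 1).indicator 1) hγ
      (fun x => ?_) (fun x hx0 hx => ?_) (fun x hx1 hx => ?_)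
    · by_cases h : x ∈ Set.Ioc (1 - δ) 1 <;> simp [h]
    · refine Set.indicator_of_notMem (fun h => ?_) _
      exact absurd h.1 (not_lt.2 (hx.le.trans (min_le_right _ _)))
    · exact Set.indicator_of_mem
        (show x ∈ Set.Ioc (1 - δ) 1 from ⟨by linarith [min_le_left δ (1 - δ)], hx1⟩) _
  -- The indicator of [0, δ) is 1 near 0 and 0 near 1, so its complement is the admissible test
  -- function.
  · have h := tendsto_average_coordinateInfo hF.1 hw1 (χ := fun x => 1 - (Set.Ico 0 δ).indicator 1 x)
      hγ (fun x => ?_) (fun x hx0 hx => ?_) (fun x hx1 hx => ?_)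
    · refine (h.const_sub 1).congr fun n => ?_
      have h2 : (2 : ℝ) ^ n ≠ 0 := by positivity
      simp only [Finset.sum_sub_distrib, Finset.sum_const, Finset.card_univ, Fintype.card_fin,
        nsmul_eq_mul, mul_one]
      push_cast
      field_simp
      ring
    · by_cases h : x ∈ Set.Ico 0 δ <;> simp [h]
    · rw [Set.indicator_of_mem (show x ∈ Set.Ico 0 δ from ⟨hx0, hx.trans_le (min_le_left _ _)⟩)]
      simp
    · rw [Set.indicator_of_notMem, sub_zero]
      exact fun h => by linarith [h.2, min_le_right δ (1 - δ)]
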